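/- Let $a(\zeta)=-1/\bar\zeta$ be the antipodal map of $\mathbb{CP}^1$. A \emph{twistor group} is a complex manifold $\mathcal G$ with a holomorphic submersion $\pi:\mathcal G\to\mathbb{CP}^1$, with holomorphic maps over $\mathbb{CP}^1$ (multiplication $\mathcal G\times_{\mathbb{CP}^1}\mathcal G\to\mathcal G$, inverse $\mathcal G\to\mathcal G$, identity section $\mathbb{CP}^1\to\mathcal G$) satisfying the group axioms fibrewise, and with an antiholomorphic involution $\tau$ of $\mathcal G$ covering $a$ and compatible with the group operations. Isomorphisms of twistor groups are biholomorphic maps over $\mathbb{CP}^1$ which commute with the multiplications and with the real structures $\tau$. For open $U\subset\mathbb{CP}^1$ let $\mathcal G_U=\pi^{-1}(U)$, a group over $U$. A twistor group $\mathcal H$ is \emph{locally isomorphic} to $\mathcal G$ if every point of $\mathbb{CP}^1$ has a neighbourhood $U$ with $\mathcal H_U\simeq\mathcal G_U$ as groups over $U$ (biholomorphic, over $U$, multiplicative). Let $\mathcal F$ be a sheaf of groups on $\mathbb{CP}^1$ with a real structure, i.e. isomorphisms $\mathcal F(U)\to\mathcal F(a(U))$, $f\mapsto\bar f$, compatible with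 restrictions and with $\bar{\bar f}=f$. A real covering is an open covering $\{U_i\}_{i\in I}$ of $\mathbb{CP}^1$ with an involution $i\mapsto\bar\imath$ of $I$ such that $U_{\bar\imath}=a(U_i)$. A real cocycle on it is a family $\phi_{ij}\in\mathcal F(U_i\cap U_j)$ with $\phi_{ij}\phi_{jk}=\phi_{ik}$ on $U_i\cap U_j\cap U_k$ and $\phi_{\bar\imath\bar\jmath}=\overline{\phi_{ij}}$. $H^1_{\mathbb R}(\mathbb{CP}^1,\mathcal F)$ is the set of classes of real cocycles (on all real coverings), where two real cocycles $\phi,\psi$ are equivalent if, after passing to a common real refinement $\{W_k\}$ (with refinement maps of index sets commuting with the involutions), $\psi_{kl}=\lambda_k\phi_{kl}\lambda_l^{-1}$ for some $\lambda_k\in\mathcal F(W_k)$ with $\lambda_{\bar k}=\overline{\lambda_k}$. (1) Let $\mathcal G$ be a twistor group and let $\mathcal A$ be the sheaf for which $\mathcal A(U)$ is the group of automorphisms of the group $\mathcal G_U$ over $U$, with real structure $\bar\phi=\tau\circ\phi\circ\tau$. Then there is a bijection from the set of isomorphism classes of twistor groups locally isomorphic to $\mathcal G$ onto $H^1_{\mathbb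 R}(\mathbb{CP}^1,\mathcal A)$, under which the class of $\mathcal H$ corresponds to the class of a real cocycle $(U_i,\phi_{ij})$ if and only if $\mathcal H$ is obtained by gluing the $\mathcal G_{U_i}$ via the $\phi_{ij}$; that is, there are isomorphisms $h_i:\mathcal H_{U_i}\to\mathcal G_{U_i}$ of groups over $U_i$ with $h_{\bar\imath}\circ\tau=\tau\circ h_i$ and $h_i=\phi_{ij}h_j$ over $U_i\cap U_j$. (2) Let $G$ be a complex Lie group with an antiholomorphic involutive automorphism $\sigma$, let $\underline G=G\times\mathbb{CP}^1$ be the trivial twistor group, with real structure $(\sigma,a)$, and let $\mathcal O(\operatorname{Aut}G)$ be the sheaf of holomorphic maps to $\operatorname{Aut}(G)$ (families $f(x)$ of automorphisms of $G$ such that $(x,g)\mapsto f(x)(g)$ and $(x,g)\mapsto f(x)^{-1}(g)$ are holomorphic), with real structure $\bar f(x)=\sigma\circ f(a(x))\circ\sigma$. Then there is a bijection from the set of isomorphism classes of twistor groups locally isomorphic to $\underline G$ (the locally trivial twistor groups with structure group $G$) onto $H^1_{\mathbb R}(\mathbb{CP}^1,\mathcal O(\operatorname{Aut}G))$, under which the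 class of $\mathcal H$ corresponds to the class of $(U_i,\phi_{ij})$ if and only if $\mathcal H$ is obtained by gluing the groups $G\times U_i$ via the maps $(g,x)\mapsto(\phi_{ij}(x)g,x)$, compatibly with the real structures as in (1). -/

import Mathlib

open Set Filter Topology TopologicalSpace
open scoped Manifold ContDiff ComplexConjugate

universe u

noncomputable section

namespace Twistor

section Sandwich

variable {E F : Type*} [NormedAddCommGroup E] [NormedSpace ℂ E]
  [NormedAddCommGroup F] [NormedSpace ℂ F] [StarAddMonoid E] [NormedStarGroup E] [StarModule ℂ E]
  [StarAddMonoid F] [NormedStarGroup F] [StarModule ℂ F]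

/-- The multilinear map `v ↦ conj (p (conj v))`. -/
def conjMultilinear {n : ℕ} (p : ContinuousMultilinearMap ℂ (fun _ : Fin n => E) F) :
    ContinuousMultilinearMap ℂ (fun _ : Fin n => E) F where
  toFun v := star (p fun i => star (v i))
  map_update_add' v i a b := by
    have h (c : E) : (fun j => star (Function.update v i c j))
        = Function.update (fun j => star (v j)) i (star c) := by
      ext j; by_cases hj : j = i
      · subst hj; simp
      · simp [hj]
    have e := p.map_update_add (fun j => star (v j)) i (star a) (star b)
    rw [← star_add, ← h, ← h, ← h] at e
    rw [← star_add]
    convert congrArg star e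
  map_update_smul' v i c a := by
    have h (c : E) : (fun j => star (Function.update v i c j))
        = Function.update (fun j => star (v j)) i (star c) := by
      ext j; by_cases hj : j = i
      · subst hj; simp
      · simp [hj]
    have e := p.map_update_smul (fun j => star (v j)) i (star c) (star a)
    rw [← star_smul, ← h, ← h] at e
    have e2 := congrArg star e
    rw [star_smul, star_star] at e2
    convert e2
  cont := by
    have : Continuous fun v : Fin n → E => fun i => star (v i) := by fun_prop
    exact (p.cont.comp this).star

theorem norm_conjMultilinear_le {n : ℕ}
    (p : ContinuousMultilinearMap ℂ (fun _ : Fin n => E) F) : ‖conjMultilinear p‖ ≤ ‖p‖ := by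
  refine ContinuousMultilinearMap.opNorm_le_bound (norm_nonneg _) fun m => ?_
  have := p.le_opNorm fun i => star (m i)
  simp only [norm_star] at this
  calc _ = ‖p fun i => star (m i)‖ := norm_star _
    _ ≤ _ := this

theorem analyticAt_star_star {f : E → F} {x : E}
    (hf : AnalyticAt ℂ f (star x)) : AnalyticAt ℂ (fun y => star (f (star y))) x := by
  obtain ⟨p, r, hp⟩ := hf
  refine ⟨fun n => conjMultilinear (p n), r, ?_, hp.r_pos, ?_⟩
  · refine hp.r_le.trans (FormalMultilinearSeries.radius_le_of_le ?_)
    intro n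
    exact norm_conjMultilinear_le _
  · intro y hy
    have hy' : star y ∈ Metric.eball (0 : E) r := by
      rw [Metric.mem_eball, edist_zero_right] at hy ⊢
      rwa [← ofReal_norm, norm_star, ofReal_norm]
    have h2 := (hp.hasSum hy').star
    rw [← star_add] at h2
    exact h2

end Sandwich

/-- The complex projective line, as the Riemann sphere `ℂ ∪ {∞}`. -/
abbrev CP1 : Type := OnePoint ℂ

open Classical in
/-- The antipodal map `ζ ↦ -1/conj ζ`. -/
def antipode : CP1 → CP1
  | none => ((0 : ℂ) : CP1)
  | some z => if z = 0 then OnePoint.infty else ((-(conj z)⁻¹ : ℂ) : CP1)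

theorem antipode_infty : antipode OnePoint.infty = ((0 : ℂ) : CP1) := rfl
theorem antipode_zero : antipode ((0 : ℂ) : CP1) = OnePoint.infty := if_pos rfl
theorem antipode_coe {z : ℂ} (hz : z ≠ 0) : antipode (z : CP1) = ((-(conj z)⁻¹ : ℂ) : CP1) :=
  if_neg hz

theorem antipode_antipode (x : CP1) : antipode (antipode x) = x := by
  induction x using OnePoint.rec with
  | infty => rw [antipode_infty, antipode_zero]
  | coe z =>
    by_cases hz : z = 0
    · subst hz; rw [antipode_zero, antipode_infty]
    · rw [antipode_coe hz, antipode_coe (by simpa using hz)]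
      simp

theorem continuous_antipode : Continuous antipode := by
  rw [OnePoint.continuous_iff, antipode_infty]
  constructor
  · rw [coclosedCompact_eq_cocompact, ← Metric.cobounded_eq_cocompact]
    have h1 : Tendsto (fun z : ℂ => -(conj z)⁻¹) (Bornology.cobounded ℂ) (𝓝 0) := by
      have h0 : Tendsto (fun z : ℂ => -conj z⁻¹) (Bornology.cobounded ℂ) (𝓝 (-conj 0)) :=
        ((Complex.continuous_conj.tendsto 0).comp (tendsto_inv₀_cobounded (α := ℂ))).neg
      simpa using h0
    have h2 := (OnePoint.continuous_coe.tendsto (0 : ℂ)).comp h1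
    refine h2.congr' ?_
    filter_upwards [Bornology.eventually_ne_cobounded (0 : ℂ)] with z hz
    rw [antipode_coe hz]; rfl
  · rw [continuous_iff_continuousAt]
    intro z
    by_cases hz : z = 0
    · subst hz
      rw [continuousAt_iff_punctured_nhds, antipode_zero]
      have h1 : Tendsto (fun z : ℂ => -(conj z)⁻¹) (𝓝[≠] 0) (Bornology.cobounded ℂ) := by
        have h0 : Tendsto (fun z : ℂ => z⁻¹) (𝓝[≠] 0) (Bornology.cobounded ℂ) :=
          tendsto_inv₀_nhdsNE_zero
        rw [← tendsto_norm_atTop_iff_cobounded] at h0 ⊢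
        refine h0.congr fun z => ?_
        simp
      have h2 : Tendsto (fun z : ℂ => ((-(conj z)⁻¹ : ℂ) : CP1)) (𝓝[≠] 0) (𝓝 OnePoint.infty) := by
        refine OnePoint.tendsto_coe_infty.comp ?_
        rwa [coclosedCompact_eq_cocompact, ← Metric.cobounded_eq_cocompact]
      refine h2.congr' ?_
      filter_upwards [self_mem_nhdsWithin] with z hz
      rw [antipode_coe hz]
    · have h1 : ContinuousAt (fun z : ℂ => -(conj z)⁻¹) z :=
        (Complex.continuous_conj.continuousAt.inv₀ (by simpa using hz)).neg
      have h2 := (OnePoint.continuous_coe (X := ℂ)).continuousAt.comp h1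
      refine h2.congr ?_
      filter_upwards [isOpen_ne.mem_nhds hz] with w hw
      rw [antipode_coe hw]; rfl

def antipodeHomeo : CP1 ≃ₜ CP1 where
  toFun := antipode
  invFun := antipode
  left_inv := antipode_antipode
  right_inv := antipode_antipode
  continuous_toFun := continuous_antipode
  continuous_invFun := continuous_antipode

/-- The affine coordinate `ζ` on `ℂP¹ ∖ {∞}`. -/
def chartZero : OpenPartialHomeomorph CP1 ℂ :=
  (OnePoint.isOpenEmbedding_coe.toOpenPartialHomeomorph ((↑) : ℂ → CP1)).symm

/-- The affine coordinate `-1/ζ` on `ℂP¹ ∖ {0}`, i.e. the conjugate of `ζ` at the antipode. -/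
def chartInfty : OpenPartialHomeomorph CP1 ℂ :=
  (antipodeHomeo.toOpenPartialHomeomorph.trans chartZero).trans
    Complex.conjLIE.toHomeomorph.toOpenPartialHomeomorph

theorem chartZero_source : chartZero.source = {OnePoint.infty}ᶜ := by
  simp only [chartZero, OpenPartialHomeomorph.symm_source, Topology.IsOpenEmbedding.toOpenPartialHomeomorph_target, ← OnePoint.compl_range_coe, compl_compl]
theorem chartZero_target : chartZero.target = univ := by
  simp [chartZero]
theorem chartZero_coe (z : ℂ) : chartZero (z : CP1) = z :=
  (OnePoint.isOpenEmbedding_coe.toOpenPartialHomeomorph ((↑) : ℂ → CP1)).left_inv (by simp)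
theorem chartZero_symm (z : ℂ) : chartZero.symm z = (z : CP1) := rfl
theorem chartInfty_apply (x : CP1) : chartInfty x = conj (chartZero (antipode x)) := rfl
theorem chartInfty_symm (z : ℂ) : chartInfty.symm z = antipode ((conj z : ℂ) : CP1) := rfl
theorem chartInfty_source : chartInfty.source = {((0 : ℂ) : CP1)}ᶜ := by
  ext x
  have : antipode x = OnePoint.infty ↔ x = ((0 : ℂ) : CP1) := by
    constructor
    · intro h; rw [← antipode_antipode x, h, antipode_infty]
    · rintro rfl; exact antipode_zero
  simp [chartInfty, chartZero_source, antipodeHomeo, this]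
theorem chartInfty_target : chartInfty.target = univ := by
  simp [chartInfty, chartZero_target]

open Classical in
instance : ChartedSpace ℂ CP1 where
  atlas := {chartZero, chartInfty}
  chartAt x := if x = OnePoint.infty then chartInfty else chartZero
  mem_chart_source x := by
    split_ifs with h
    · subst h; simp [chartInfty_source]
    · simpa [chartZero_source] using h
  chart_mem_atlas x := by split_ifs <;> simp

theorem chartInfty_coe {z : ℂ} (hz : z ≠ 0) : chartInfty (z : CP1) = -z⁻¹ := by
  rw [chartInfty_apply, antipode_coe hz, chartZero_coe]; simp

instance : IsManifold 𝓘(ℂ) ω CP1 := by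
  apply isManifold_of_contDiffOn
  have hinv : ContDiffOn ℂ ω (fun z : ℂ => -z⁻¹) {0}ᶜ := fun z hz =>
    ((contDiffAt_inv ℂ hz).neg).contDiffWithinAt
  have key (z : ℂ) (hz : z ≠ 0) : antipode ((conj z : ℂ) : CP1) = ((-z⁻¹ : ℂ) : CP1) := by
    rw [antipode_coe (by simpa using hz)]; simp
  rintro e e' (rfl | rfl) (rfl | rfl)
  · refine contDiffOn_id.congr fun z _ => ?_
    simp [chartZero_symm, chartZero_coe]
  · refine (hinv.mono ?_).congr ?_
    all_goals
      intro z hz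
      have hz : z ≠ 0 := by simpa [chartZero_symm, chartInfty_source, chartZero_target] using hz
    · exact hz
    · simp [chartZero_symm, chartInfty_coe hz]
  · refine (hinv.mono ?_).congr ?_
    all_goals
      intro z hz
      have hz : z ≠ 0 := by
        rintro rfl
        simp [chartInfty_symm, chartZero_source, chartInfty_target, antipode_zero] at hz
    · exact hz
    · simp [chartInfty_symm, key z hz, chartZero_coe]
  · refine contDiffOn_id.congr fun z _ => ?_
    simp [chartInfty_symm, chartInfty_apply, antipode_antipode, chartZero_coe]


section Anti

variable {E F P : Type*} [NormedAddCommGroup E] [NormedSpace ℂ E]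
  [NormedAddCommGroup F] [NormedSpace ℂ F] [NormedAddCommGroup P] [NormedSpace ℂ P]
  {M N Q : Type*} [TopologicalSpace M] [ChartedSpace E M] [TopologicalSpace N] [ChartedSpace F N]
  [TopologicalSpace Q] [ChartedSpace P Q]

/-- A map of complex manifolds is antiholomorphic if it is continuous and pulls back germs of
holomorphic functions to germs of antiholomorphic functions. -/
structure AntiHolomorphic (E F : Type*) [NormedAddCommGroup E] [NormedSpace ℂ E]
    [NormedAddCommGroup F] [NormedSpace ℂ F] {M N : Type*} [TopologicalSpace M] [ChartedSpace E M]
    [TopologicalSpace N] [ChartedSpace F N] (f : M → N) : Prop where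
  continuous : Continuous f
  pullback : ∀ (x : M) (h : N → ℂ), ContMDiffAt 𝓘(ℂ, F) 𝓘(ℂ) ω h (f x) →
    ContMDiffAt 𝓘(ℂ, E) 𝓘(ℂ) ω (fun y => conj (h (f y))) x

theorem AntiHolomorphic.comp_contMDiff {g : N → Q} {f : M → N} (hg : AntiHolomorphic F P g)
    (hf : ContMDiff 𝓘(ℂ, E) 𝓘(ℂ, F) ω f) : AntiHolomorphic E P (fun x => g (f x)) where
  continuous := hg.continuous.comp hf.continuous
  pullback x h hh := (hg.pullback (f x) h hh).comp x hf.contMDiffAt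

theorem AntiHolomorphic.contMDiff_comp {g : N → Q} {f : M → N}
    (hg : ContMDiff 𝓘(ℂ, F) 𝓘(ℂ, P) ω g) (hf : AntiHolomorphic E F f) :
    AntiHolomorphic E P (fun x => g (f x)) where
  continuous := hg.continuous.comp hf.continuous
  pullback x h hh := hf.pullback x (fun y => h (g y)) (hh.comp (f x) hg.contMDiffAt)

/-- Complex coordinates at a point of a finite-dimensional complex manifold. -/
def coords (F : Type*) [NormedAddCommGroup F] [NormedSpace ℂ F] [FiniteDimensional ℂ F] :
    F ≃L[ℂ] (Fin (Module.finrank ℂ F) → ℂ) :=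
  (Module.finBasis ℂ F).equivFunL

theorem contMDiffAt_coord [FiniteDimensional ℂ F] [IsManifold 𝓘(ℂ, F) ω N] (y : N)
    (i : Fin (Module.finrank ℂ F)) :
    ContMDiffAt 𝓘(ℂ, F) 𝓘(ℂ) ω (fun z => coords F (extChartAt 𝓘(ℂ, F) y z) i) y := by
  have h1 : ContMDiffAt 𝓘(ℂ, F) 𝓘(ℂ, Fin (Module.finrank ℂ F) → ℂ) ω
      (fun z => coords F (extChartAt 𝓘(ℂ, F) y z)) y :=
    ((coords F).contDiff.contMDiff.contMDiffAt).comp y contMDiffAt_extChartAt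
  exact contMDiffAt_pi_space.1 h1 i

theorem contMDiff_of_germs [FiniteDimensional ℂ F] [IsManifold 𝓘(ℂ, F) ω N] {E' H' M' : Type*}
    [NormedAddCommGroup E'] [NormedSpace ℂ E'] [TopologicalSpace H'] [TopologicalSpace M']
    [ChartedSpace H' M'] {I : ModelWithCorners ℂ E' H'} {f : M' → N} (hc : Continuous f)
    (hf : ∀ (x : M') (h : N → ℂ), ContMDiffAt 𝓘(ℂ, F) 𝓘(ℂ) ω h (f x) →
      ContMDiffAt I 𝓘(ℂ) ω (fun y => h (f y)) x) :
    ContMDiff I 𝓘(ℂ, F) ω f := by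
  intro x
  rw [contMDiffAt_iff_target]
  refine ⟨hc.continuousAt, ?_⟩
  have h1 : ContMDiffAt I 𝓘(ℂ, Fin (Module.finrank ℂ F) → ℂ) ω
      (fun z => coords F (extChartAt 𝓘(ℂ, F) (f x) (f z))) x :=
    contMDiffAt_pi_space.2 fun i => hf x _ (contMDiffAt_coord (f x) i)
  have h2 := ((coords F).symm.contDiff.contMDiff.contMDiffAt (n := ω)
    (x := coords F (extChartAt 𝓘(ℂ, F) (f x) (f x)))).comp x h1
  refine h2.congr_of_eventuallyEq (Eventually.of_forall fun z => ?_)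
  simp

theorem AntiHolomorphic.comp [FiniteDimensional ℂ P] [IsManifold 𝓘(ℂ, P) ω Q]
    {g : N → Q} {f : M → N} (hg : AntiHolomorphic F P g) (hf : AntiHolomorphic E F f) :
    ContMDiff 𝓘(ℂ, E) 𝓘(ℂ, P) ω (fun x => g (f x)) := by
  refine contMDiff_of_germs (hg.continuous.comp hf.continuous) fun x h hh => ?_
  simpa using hf.pullback x _ (hg.pullback (f x) h hh)

/-- Restriction of an antiholomorphic map to open subsets of the source and the target. -/
theorem AntiHolomorphic.restrict {f : M → N} (hf : AntiHolomorphic E F f) {U : Opens M}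
    {V : Opens N} (g : U → V) (hg : ∀ x : U, (g x : N) = f x) : AntiHolomorphic E F g where
  continuous := by
    rw [continuous_induced_rng]
    exact (hf.continuous.comp continuous_subtype_val).congr fun x => (hg x).symm
  pullback x h hh := by
    classical
    have h1 : ContMDiffAt 𝓘(ℂ, F) 𝓘(ℂ) ω (Function.extend Subtype.val h 0) (g x : N) := by
      rw [← contMDiffAt_subtype_iff]
      refine hh.congr_of_eventuallyEq (Eventually.of_forall fun z => ?_)
      exact Subtype.val_injective.extend_apply h 0 z
    rw [hg] at h1
    have h2 := hf.pullback x _ h1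
    rw [← contMDiffAt_subtype_iff] at h2
    refine h2.congr_of_eventuallyEq (Eventually.of_forall fun z => ?_)
    simp only [← hg]
    rw [Subtype.val_injective.extend_apply h 0 (g z)]

theorem AntiHolomorphic.prodMap {E' F' M' N' : Type*} [NormedAddCommGroup E'] [NormedSpace ℂ E']
    [NormedAddCommGroup F'] [NormedSpace ℂ F'] [TopologicalSpace M'] [ChartedSpace E' M']
    [TopologicalSpace N'] [ChartedSpace F' N'] [FiniteDimensional ℂ F] [FiniteDimensional ℂ F']
    [IsManifold 𝓘(ℂ, F) ω N] [IsManifold 𝓘(ℂ, F') ω N'] {f : M → N} {f' : M' → N'}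
    (hf : AntiHolomorphic E F f) (hf' : AntiHolomorphic E' F' f') (x : M × M') (h : N × N' → ℂ)
    (hh : ContMDiffAt (𝓘(ℂ, F).prod 𝓘(ℂ, F')) 𝓘(ℂ) ω h (f x.1, f' x.2)) :
    ContMDiffAt (𝓘(ℂ, E).prod 𝓘(ℂ, E')) 𝓘(ℂ) ω (fun y => conj (h (f y.1, f' y.2))) x := by
  set e := extChartAt 𝓘(ℂ, F) (f x.1) with he
  set e' := extChartAt 𝓘(ℂ, F') (f' x.2) with he'
  let H : (Fin (Module.finrank ℂ F) → ℂ) × (Fin (Module.finrank ℂ F') → ℂ) → ℂ := fun v =>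
    h (e.symm ((coords F).symm v.1), e'.symm ((coords F').symm v.2))
  let u : M → Fin (Module.finrank ℂ F) → ℂ := fun y i => conj (coords F (e (f y)) i)
  let u' : M' → Fin (Module.finrank ℂ F') → ℂ := fun y i => conj (coords F' (e' (f' y)) i)
  have hu : ContMDiffAt 𝓘(ℂ, E) 𝓘(ℂ, Fin (Module.finrank ℂ F) → ℂ) ω u x.1 :=
    contMDiffAt_pi_space.2 fun i => hf.pullback x.1 _ (contMDiffAt_coord (f x.1) i)
  have hu' : ContMDiffAt 𝓘(ℂ, E') 𝓘(ℂ, Fin (Module.finrank ℂ F') → ℂ) ω u' x.2 :=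
    contMDiffAt_pi_space.2 fun i => hf'.pullback x.2 _ (contMDiffAt_coord (f' x.2) i)
  have ex : star (u x.1) = coords F (e (f x.1)) := by ext i; simp [u]
  have ex' : star (u' x.2) = coords F' (e' (f' x.2)) := by ext i; simp [u']
  have hH : AnalyticAt ℂ H (star (u x.1, u' x.2)) := by
    refine ContDiffAt.analyticAt (contMDiffAt_iff_contDiffAt.1 ?_)
    have c1 : ContMDiffAt 𝓘(ℂ, F) 𝓘(ℂ, F) ω e.symm
        ((coords F).symm (star (u x.1))) := by
      rw [ex, ContinuousLinearEquiv.symm_apply_apply]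
      exact (contMDiffOn_extChartAt_symm (f x.1)).contMDiffAt (extChartAt_target_mem_nhds _)
    have c2 : ContMDiffAt 𝓘(ℂ, F') 𝓘(ℂ, F') ω e'.symm
        ((coords F').symm (star (u' x.2))) := by
      rw [ex', ContinuousLinearEquiv.symm_apply_apply]
      exact (contMDiffOn_extChartAt_symm (f' x.2)).contMDiffAt (extChartAt_target_mem_nhds _)
    have p1 := (((coords F).symm.contDiff.comp contDiff_fst).contMDiff (n := ω)).contMDiffAt
      (x := star (u x.1, u' x.2))
    have p2 := (((coords F').symm.contDiff.comp contDiff_snd).contMDiff (n := ω)).contMDiffAt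
      (x := star (u x.1, u' x.2))
    have q := (c1.comp (star (u x.1, u' x.2)) p1).prodMk (c2.comp (star (u x.1, u' x.2)) p2)
    refine ContMDiffAt.comp (g := h) (star (u x.1, u' x.2)) ?_ q
    have e1 : e.symm ((coords F).symm (star (u x.1))) = f x.1 := by
      rw [ex, ContinuousLinearEquiv.symm_apply_apply]; exact extChartAt_to_inv _
    have e2 : e'.symm ((coords F').symm (star (u' x.2))) = f' x.2 := by
      rw [ex', ContinuousLinearEquiv.symm_apply_apply]; exact extChartAt_to_inv _
    change ContMDiffAt _ _ ω h (e.symm ((coords F).symm (star (u x.1))),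
      e'.symm ((coords F').symm (star (u' x.2))))
    rw [e1, e2]; exact hh
  have hK := (analyticAt_star_star hH).contDiffAt (n := ω)
  have hK2 := hK.contMDiffAt.comp x ((hu.comp x contMDiffAt_fst).prodMk_space
    (hu'.comp x contMDiffAt_snd))
  refine hK2.congr_of_eventuallyEq ?_
  have n1 : ∀ᶠ y in 𝓝 x, f y.1 ∈ e.source :=
    (hf.continuous.comp continuous_fst).continuousAt.eventually (extChartAt_source_mem_nhds _)
  have n2 : ∀ᶠ y in 𝓝 x, f' y.2 ∈ e'.source :=
    (hf'.continuous.comp continuous_snd).continuousAt.eventually (extChartAt_source_mem_nhds _)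
  filter_upwards [n1, n2] with y h1 h2
  have a1 : star (u y.1) = coords F (e (f y.1)) := by ext i; simp [u]
  have a2 : star (u' y.2) = coords F' (e' (f' y.2)) := by ext i; simp [u']
  simp [H, a1, a2, e.left_inv h1, e'.left_inv h2]

end Anti

theorem antipode_pullback {e e' : OpenPartialHomeomorph CP1 ℂ} (he : e ∈ atlas ℂ CP1)
    (he' : e' ∈ atlas ℂ CP1) (ht : e'.target = univ)
    (hee : ∀ y ∈ e.source, antipode y = e'.symm (conj (e y))) {x : CP1} (hx : x ∈ e.source)
    (h : CP1 → ℂ) (hh : ContMDiffAt 𝓘(ℂ) 𝓘(ℂ) ω h (antipode x)) :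
    ContMDiffAt 𝓘(ℂ) 𝓘(ℂ) ω (fun y => conj (h (antipode y))) x := by
  have c1 : ContMDiffAt 𝓘(ℂ) 𝓘(ℂ) ω e'.symm (conj (e x)) :=
    (contMDiffOn_symm_of_mem_maximalAtlas
      (IsManifold.subset_maximalAtlas he')).contMDiffAt (by simp [ht])
  have c2 : ContMDiffAt 𝓘(ℂ) 𝓘(ℂ) ω (fun z => h (e'.symm z)) (conj (e x)) :=
    ContMDiffAt.comp (conj (e x)) (by rwa [hee x hx] at hh) c1
  have c3 : AnalyticAt ℂ (fun z => conj (h (e'.symm (conj z)))) (e x) :=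
    analyticAt_star_star (E := ℂ) (F := ℂ) (f := fun z => h (e'.symm z))
      (contMDiffAt_iff_contDiffAt.1 c2).analyticAt
  have c4 := (c3.contDiffAt (n := ω)).contMDiffAt.comp x
    (contMDiffAt_of_mem_maximalAtlas (I := 𝓘(ℂ)) (n := ω)
      (IsManifold.subset_maximalAtlas he) hx)
  refine c4.congr_of_eventuallyEq ?_
  filter_upwards [e.open_source.mem_nhds hx] with y hy
  simp [hee y hy]

theorem antiHolomorphic_antipode : AntiHolomorphic ℂ ℂ antipode where
  continuous := continuous_antipode
  pullback x h hh := by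
    have m0 : chartZero ∈ atlas ℂ CP1 := Or.inl rfl
    have m1 : chartInfty ∈ atlas ℂ CP1 := Or.inr rfl
    by_cases hx : x = OnePoint.infty
    · refine antipode_pullback m1 m0 chartZero_target (fun y hy => ?_) ?_ h hh
      · have := chartInfty.left_inv hy
        conv_lhs => rw [← this]
        rw [chartInfty_symm, antipode_antipode, chartZero_symm]
      · subst hx; simp [chartInfty_source]
    · refine antipode_pullback m0 m1 chartInfty_target (fun y hy => ?_) ?_ h hh
      · have := chartZero.left_inv hy
        conv_lhs => rw [← this]
        rw [chartInfty_symm, chartZero_symm]; simp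
      · simpa [chartZero_source] using hx

theorem contMDiff_codRestrict {E F : Type*} [NormedAddCommGroup E] [NormedSpace ℂ E]
    [NormedAddCommGroup F] [NormedSpace ℂ F] {M N : Type*} [TopologicalSpace M] [ChartedSpace E M]
    [TopologicalSpace N] [ChartedSpace F N] {V : Opens N} {f : M → V}
    (hf : ContMDiff 𝓘(ℂ, E) 𝓘(ℂ, F) ω (fun x => (f x : N))) :
    ContMDiff 𝓘(ℂ, E) 𝓘(ℂ, F) ω f := fun x =>
  (ChartedSpace.liftPropWithinAt_subtypeVal_comp_iff f univ x).1 (hf x)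

/-- A group in the category of smooth spaces with a real structure over `ℂP¹`: a complex manifold
with a holomorphic submersion `proj` to `ℂP¹`, fibrewise group operations which are holomorphic,
and an antiholomorphic involution `τ` covering the antipodal map and compatible with the group
operations. Only the values of `mul` on pairs of points in a common fibre are meaningful; being
analytic along the fibre product means locally extending to a holomorphic map on the product. -/
structure TwistorGroup : Type (u + 1) where
  Model : Type u
  [normedAddCommGroup : NormedAddCommGroup Model]
  [normedSpace : NormedSpace ℂ Model]
  [finiteDimensional : FiniteDimensional ℂ Model]
  Total : Type u
  [topologicalSpace : TopologicalSpace Total]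
  [t2Space : T2Space Total]
  [chartedSpace : ChartedSpace Model Total]
  [isManifold : IsManifold 𝓘(ℂ, Model) ω Total]
  proj : Total → CP1
  contMDiff_proj : ContMDiff 𝓘(ℂ, Model) 𝓘(ℂ) ω proj
  submersion : ∀ a, Function.Surjective (mfderiv 𝓘(ℂ, Model) 𝓘(ℂ) proj a)
  mul : Total → Total → Total
  one : CP1 → Total
  inv : Total → Total
  proj_mul : ∀ a b, proj a = proj b → proj (mul a b) = proj a
  proj_one : ∀ x, proj (one x) = x
  proj_inv : ∀ a, proj (inv a) = proj a
  mul_assoc : ∀ a b c, proj a = proj b → proj b = proj c → mul (mul a b) c = mul a (mul b c)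
  one_mul : ∀ a, mul (one (proj a)) a = a
  mul_one : ∀ a, mul a (one (proj a)) = a
  inv_mul : ∀ a, mul (inv a) a = one (proj a)
  contMDiffOn_mul : ContMDiffOn (𝓘(ℂ, Model).prod 𝓘(ℂ, Model)) 𝓘(ℂ, Model) ω
    (fun p : Total × Total => mul p.1 p.2) {p | proj p.1 = proj p.2}
  contMDiff_one : ContMDiff 𝓘(ℂ) 𝓘(ℂ, Model) ω one
  contMDiff_inv : ContMDiff 𝓘(ℂ, Model) 𝓘(ℂ, Model) ω inv
  τ : Total → Total
  antiHolomorphic_τ : AntiHolomorphic Model Model τ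
  τ_τ : ∀ a, τ (τ a) = a
  proj_τ : ∀ a, proj (τ a) = antipode (proj a)
  τ_mul : ∀ a b, proj a = proj b → τ (mul a b) = mul (τ a) (τ b)
  τ_one : ∀ x, τ (one x) = one (antipode x)
  τ_inv : ∀ a, τ (inv a) = inv (τ a)

attribute [instance] TwistorGroup.normedAddCommGroup TwistorGroup.normedSpace
  TwistorGroup.finiteDimensional TwistorGroup.topologicalSpace TwistorGroup.t2Space
  TwistorGroup.chartedSpace TwistorGroup.isManifold

/-- The image of an open set under the antipodal map. -/
def antipodeOpens (U : Opens CP1) : Opens CP1 :=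
  ⟨antipode ⁻¹' U, U.isOpen.preimage continuous_antipode⟩

theorem mem_antipodeOpens {U : Opens CP1} {x : CP1} : x ∈ antipodeOpens U ↔ antipode x ∈ U :=
  Iff.rfl

theorem antipode_mem {U : Opens CP1} {x : CP1} (hx : x ∈ U) : antipode x ∈ antipodeOpens U := by
  rwa [mem_antipodeOpens, antipode_antipode]

theorem antipodeOpens_mono {V U : Opens CP1} (h : V ≤ U) : antipodeOpens V ≤ antipodeOpens U :=
  fun _ hx => h hx

theorem le_antipodeOpens_antipodeOpens (U : Opens CP1) : U ≤ antipodeOpens (antipodeOpens U) :=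
  fun _ hx => antipode_mem hx

namespace TwistorGroup

variable (G H K : TwistorGroup.{u})

/-- An isomorphism of twistor groups. -/
structure IsIso (e : G.Total ≃ H.Total) : Prop where
  contMDiff : ContMDiff 𝓘(ℂ, G.Model) 𝓘(ℂ, H.Model) ω e
  contMDiff_symm : ContMDiff 𝓘(ℂ, H.Model) 𝓘(ℂ, G.Model) ω e.symm
  proj : ∀ a, H.proj (e a) = G.proj a
  map_mul : ∀ a b, G.proj a = G.proj b → e (G.mul a b) = H.mul (e a) (e b)
  map_τ : ∀ a, e (G.τ a) = H.τ (e a)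

/-- The restriction of a twistor group to an open subset of `ℂP¹`. -/
def restr (U : Opens CP1) : Opens G.Total :=
  ⟨G.proj ⁻¹' U, U.isOpen.preimage G.contMDiff_proj.continuous⟩

variable {G H K}

theorem mem_restr {U : Opens CP1} {a : G.Total} : a ∈ G.restr U ↔ G.proj a ∈ U := Iff.rfl

/-- The product of two points of a restriction which lie in the same fibre. -/
def overMul {U : Opens CP1} (a b : G.restr U) (hab : G.proj a = G.proj b) : G.restr U :=
  ⟨G.mul a b, by rw [mem_restr, G.proj_mul _ _ hab]; exact a.2⟩

/-- The real structure as a map from the part over `U` to the part over the antipodal image. -/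
def overτ {U : Opens CP1} (a : G.restr U) : G.restr (antipodeOpens U) :=
  ⟨G.τ a, by rw [mem_restr, G.proj_τ]; exact antipode_mem a.2⟩

/-- The real structure as a map from the part over the antipodal image of `U` to that over `U`. -/
def overτ' {U : Opens CP1} (a : G.restr (antipodeOpens U)) : G.restr U :=
  ⟨G.τ a, by rw [mem_restr, G.proj_τ]; exact a.2⟩

theorem overτ'_overτ {U : Opens CP1} (a : G.restr U) : overτ' (overτ a) = a :=
  Subtype.ext (G.τ_τ a)

/-- An isomorphism over `U` between the restrictions to `U`, as groups over `U`: a biholomorphic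
map, commuting with the projections and with the fibrewise multiplications. -/
structure IsOverIso {U : Opens CP1} (e : G.restr U ≃ H.restr U) : Prop where
  contMDiff : ContMDiff 𝓘(ℂ, G.Model) 𝓘(ℂ, H.Model) ω e
  contMDiff_symm : ContMDiff 𝓘(ℂ, H.Model) 𝓘(ℂ, G.Model) ω e.symm
  proj : ∀ a : G.restr U, H.proj (e a) = G.proj a
  map_mul : ∀ (a b : G.restr U) (hab : G.proj a = G.proj b),
    (e (overMul a b hab) : H.Total) = H.mul (e a) (e b)

theorem IsOverIso.refl (U : Opens CP1) : IsOverIso (Equiv.refl (G.restr U)) where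
  contMDiff := contMDiff_id
  contMDiff_symm := contMDiff_id
  proj _ := rfl
  map_mul _ _ _ := rfl

theorem IsOverIso.proj_symm {U : Opens CP1} {e : G.restr U ≃ H.restr U} (he : IsOverIso e)
    (a : H.restr U) : G.proj (e.symm a) = H.proj a := by
  rw [← he.proj, e.apply_symm_apply]

theorem IsOverIso.symm {U : Opens CP1} {e : G.restr U ≃ H.restr U} (he : IsOverIso e) :
    IsOverIso e.symm where
  contMDiff := he.contMDiff_symm
  contMDiff_symm := he.contMDiff
  proj := he.proj_symm
  map_mul a b hab := by
    have hab' : G.proj (e.symm a) = G.proj (e.symm b) := by rw [he.proj_symm, he.proj_symm, hab]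
    have h1 : e (overMul (e.symm a) (e.symm b) hab') = overMul a b hab := by
      apply Subtype.ext
      rw [he.map_mul, e.apply_symm_apply, e.apply_symm_apply]
      rfl
    rw [← h1, e.symm_apply_apply]
    rfl

theorem IsOverIso.trans {U : Opens CP1} {e : G.restr U ≃ H.restr U} {e' : H.restr U ≃ K.restr U}
    (he : IsOverIso e) (he' : IsOverIso e') : IsOverIso (e.trans e') where
  contMDiff := he'.contMDiff.comp he.contMDiff
  contMDiff_symm := he.contMDiff_symm.comp he'.contMDiff_symm
  proj a := by rw [Equiv.trans_apply, he'.proj, he.proj]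
  map_mul a b hab := by
    have hab' : H.proj (e a) = H.proj (e b) := by rw [he.proj, he.proj, hab]
    have h1 : e (overMul a b hab) = overMul (e a) (e b) hab' := Subtype.ext (he.map_mul a b hab)
    rw [Equiv.trans_apply, h1, he'.map_mul]
    rfl

/-- Restriction of an isomorphism over `U` to a smaller open set `V`. -/
def IsOverIso.restrict {U V : Opens CP1} {e : G.restr U ≃ H.restr U} (he : IsOverIso e)
    (h : V ≤ U) : G.restr V ≃ H.restr V where
  toFun a := ⟨e ⟨a, h a.2⟩, by rw [mem_restr, he.proj]; exact a.2⟩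
  invFun a := ⟨e.symm ⟨a, h a.2⟩, by rw [mem_restr, he.proj_symm]; exact a.2⟩
  left_inv a := by
    have h1 := e.symm_apply_apply ⟨a, h a.2⟩
    have h2 := congrArg Subtype.val h1
    exact Subtype.ext h2
  right_inv a := by
    have h1 := e.apply_symm_apply ⟨a, h a.2⟩
    have h2 := congrArg Subtype.val h1
    exact Subtype.ext h2

theorem contMDiff_overInclusion {U V : Opens CP1} (h : V ≤ U) :
    ContMDiff 𝓘(ℂ, G.Model) 𝓘(ℂ, G.Model) ω (fun a : G.restr V => (⟨a, h a.2⟩ : G.restr U)) :=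
  contMDiff_inclusion (U := G.restr V) (V := G.restr U) fun _ hx => h hx

theorem IsOverIso.isOverIso_restrict {U V : Opens CP1} {e : G.restr U ≃ H.restr U}
    (he : IsOverIso e) (h : V ≤ U) : IsOverIso (he.restrict h) where
  contMDiff := by
    have h1 := contMDiff_subtype_val.comp (he.contMDiff.comp (contMDiff_overInclusion h))
    exact contMDiff_codRestrict (V := H.restr V) (f := he.restrict h) h1
  contMDiff_symm := by
    have h1 := contMDiff_subtype_val.comp (he.contMDiff_symm.comp (contMDiff_overInclusion h))
    exact contMDiff_codRestrict (V := G.restr V) (f := (he.restrict h).symm) h1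
  proj a := he.proj ⟨a, h a.2⟩
  map_mul a b hab := he.map_mul ⟨a, h a.2⟩ ⟨b, h b.2⟩ hab

/-- The conjugate `τ ∘ e ∘ τ` of a map over `U`, a map over the antipodal image of `U`. -/
def overConj {U : Opens CP1} (e : G.restr U ≃ H.restr U) :
    G.restr (antipodeOpens U) ≃ H.restr (antipodeOpens U) where
  toFun a := overτ (e (overτ' a))
  invFun a := overτ (e.symm (overτ' a))
  left_inv a := by
    simp only [overτ'_overτ, e.symm_apply_apply]
    exact Subtype.ext (G.τ_τ a)
  right_inv a := by
    simp only [overτ'_overτ, e.apply_symm_apply]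
    exact Subtype.ext (H.τ_τ a)

theorem contMDiff_overConj {U : Opens CP1} {e : G.restr U → H.restr U}
    (he : ContMDiff 𝓘(ℂ, G.Model) 𝓘(ℂ, H.Model) ω e) :
    ContMDiff 𝓘(ℂ, G.Model) 𝓘(ℂ, H.Model) ω
      (fun a : G.restr (antipodeOpens U) => overτ (e (overτ' a))) :=
  AntiHolomorphic.comp
    (H.antiHolomorphic_τ.restrict (U := H.restr U) (V := H.restr (antipodeOpens U)) overτ
      fun _ => rfl)
    (AntiHolomorphic.contMDiff_comp he
      (G.antiHolomorphic_τ.restrict (U := G.restr (antipodeOpens U)) (V := G.restr U) overτ'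
        fun _ => rfl))

theorem IsOverIso.isOverIso_overConj {U : Opens CP1} {e : G.restr U ≃ H.restr U}
    (he : IsOverIso e) : IsOverIso (overConj e) where
  contMDiff := contMDiff_overConj he.contMDiff
  contMDiff_symm := contMDiff_overConj he.contMDiff_symm
  proj a := by
    change H.proj (H.τ (e (overτ' a))) = _
    rw [H.proj_τ, he.proj]
    change antipode (G.proj (G.τ a)) = _
    rw [G.proj_τ, antipode_antipode]
  map_mul a b hab := by
    have hab' : G.proj (overτ' a) = G.proj (overτ' b) := by
      change G.proj (G.τ a) = G.proj (G.τ b)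
      rw [G.proj_τ, G.proj_τ, hab]
    have h1 : overτ' (overMul a b hab) = overMul (overτ' a) (overτ' b) hab' :=
      Subtype.ext (G.τ_mul a b hab)
    change H.τ (e (overτ' (overMul a b hab))) = H.mul (H.τ (e (overτ' a))) (H.τ (e (overτ' b)))
    rw [h1, he.map_mul, H.τ_mul]
    rw [he.proj, he.proj, hab']

end TwistorGroup

/-- A presheaf of groups on `ℂP¹` with a real structure: an involutive family of isomorphisms
`conjSec` from sections over `U` to sections over the antipodal image of `U`. -/
structure RealGroupPresheaf : Type (u + 1) where
  sec : Opens CP1 → Type u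
  [group : ∀ U, Group (sec U)]
  res : ∀ {V U : Opens CP1}, V ≤ U → sec U →* sec V
  res_refl : ∀ {U : Opens CP1} (a : sec U), res le_rfl a = a
  res_res : ∀ {W V U : Opens CP1} (h : W ≤ V) (h' : V ≤ U) (a : sec U),
    res h (res h' a) = res (h.trans h') a
  conjSec : ∀ {U : Opens CP1}, sec U →* sec (antipodeOpens U)
  conjSec_res : ∀ {V U : Opens CP1} (h : V ≤ U) (a : sec U),
    conjSec (res h a) = res (antipodeOpens_mono h) (conjSec a)
  conjSec_conjSec : ∀ {U : Opens CP1} (a : sec U),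
    res (le_antipodeOpens_antipodeOpens U) (conjSec (conjSec a)) = a

attribute [instance] RealGroupPresheaf.group

/-- An open covering of `ℂP¹`, invariant under the antipodal map: the antipodal map sends the
`i`-th member to the `bar i`-th one. -/
structure RealCover : Type 1 where
  ι : Type
  U : ι → Opens CP1
  covers : ∀ x, ∃ i, x ∈ U i
  bar : ι → ι
  bar_bar : ∀ i, bar (bar i) = i
  U_bar : ∀ i, U (bar i) = antipodeOpens (U i)

namespace RealGroupPresheaf

variable (F : RealGroupPresheaf.{u})

/-- A `1`-cocycle of a real covering which is invariant under the real structure. -/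
structure Cocycle : Type (max u 1) where
  cover : RealCover
  φ : ∀ i j, F.sec (cover.U i ⊓ cover.U j)
  cocycle : ∀ i j k,
    F.res (le_inf (inf_le_left.trans inf_le_left) (inf_le_left.trans inf_le_right)) (φ i j) *
      F.res (le_inf (inf_le_left.trans inf_le_right) inf_le_right) (φ j k) =
    F.res (le_inf (inf_le_left.trans inf_le_left) inf_le_right :
      cover.U i ⊓ cover.U j ⊓ cover.U k ≤ cover.U i ⊓ cover.U k) (φ i k)
  real : ∀ i j, φ (cover.bar i) (cover.bar j) =
    F.res (inf_le_inf (cover.U_bar i).le (cover.U_bar j).le :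
      _ ≤ antipodeOpens (cover.U i ⊓ cover.U j)) (F.conjSec (φ i j))

variable {F}

/-- Two invariant cocycles are cohomologous if, on a common real refinement of their coverings,
they differ by the coboundary of an invariant `0`-cochain `a`. -/
def Cohomologous (c d : F.Cocycle) : Prop :=
  ∃ (W : RealCover) (r : W.ι → c.cover.ι) (s : W.ι → d.cover.ι)
    (hr : ∀ k, W.U k ≤ c.cover.U (r k)) (hs : ∀ k, W.U k ≤ d.cover.U (s k))
    (a : ∀ k, F.sec (W.U k)),
    (∀ k, r (W.bar k) = c.cover.bar (r k)) ∧ (∀ k, s (W.bar k) = d.cover.bar (s k)) ∧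
    (∀ k, a (W.bar k) = F.res (W.U_bar k).le (F.conjSec (a k))) ∧
    ∀ k l, F.res (inf_le_inf (hs k) (hs l)) (d.φ (s k) (s l)) =
      F.res inf_le_left (a k) * F.res (inf_le_inf (hr k) (hr l)) (c.φ (r k) (r l)) *
        (F.res (inf_le_right : W.U k ⊓ W.U l ≤ W.U l) (a l))⁻¹

variable (F) in
/-- The real nonabelian cohomology set `H¹_ℝ(ℂP¹, F)`: the (Čech) cohomology of invariant
cocycles, over all real coverings. Being cohomologous is an equivalence relation. -/
def H1R : Type (max u 1) := Quot (Cohomologous (F := F))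

end RealGroupPresheaf

namespace TwistorGroup

variable (G : TwistorGroup.{u})

/-- The group of automorphisms of the restriction of `G` to `U`, as a group over `U`. -/
def autGroup (U : Opens CP1) : Subgroup (Equiv.Perm (G.restr U)) where
  carrier := {e | IsOverIso e}
  mul_mem' ha hb := IsOverIso.trans hb ha
  one_mem' := IsOverIso.refl U
  inv_mem' ha := IsOverIso.symm ha

/-- The sheaf `U ↦ Aut(G_U)`, with restriction of automorphisms and conjugation by `τ`. -/
def autSheaf : RealGroupPresheaf.{u} where
  sec U := G.autGroup U
  res h :=
    { toFun := fun e => ⟨e.2.restrict h, e.2.isOverIso_restrict h⟩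
      map_one' := rfl
      map_mul' := fun _ _ => rfl }
  res_refl _ := rfl
  res_res _ _ _ := rfl
  conjSec :=
    { toFun := fun e => ⟨overConj e.1, e.2.isOverIso_overConj⟩
      map_one' := by
        apply Subtype.ext; ext a
        exact G.τ_τ a
      map_mul' := fun e e' => by
        apply Subtype.ext; ext a
        change G.τ (e.1 (e'.1 (overτ' a))) = G.τ (e.1 (overτ' (overτ (e'.1 (overτ' a)))))
        rw [overτ'_overτ] }
  conjSec_res _ _ := rfl
  conjSec_conjSec {U} e := by
    apply Subtype.ext; ext a
    change G.τ (G.τ (e.1 ⟨G.τ (G.τ a), _⟩)) = e.1 a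
    simp only [G.τ_τ]

/-- `H` is locally isomorphic to `G`: every point of `ℂP¹` has a neighbourhood over which
they are isomorphic as groups over that neighbourhood. -/
def LocallyIso (H : TwistorGroup.{u}) : Prop :=
  ∀ x : CP1, ∃ U : Opens CP1, x ∈ U ∧ ∃ e : H.restr U ≃ G.restr U, IsOverIso e

/-- The set of isomorphism classes of twistor groups locally isomorphic to `G`. -/
def LocalForms : Type (u + 1) :=
  Quot fun H K : {H : TwistorGroup.{u} // G.LocallyIso H} =>
    ∃ e : H.1.Total ≃ K.1.Total, IsIso H.1 K.1 e

/-- A family of isomorphisms `H_{U_i} ≃ G_{U_i}` for a real covering, equivariant under the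
real structures. -/
structure Trivialization (H : TwistorGroup.{u}) (c : RealCover) where
  map : ∀ i, H.restr (c.U i) ≃ G.restr (c.U i)
  isOverIso : ∀ i, IsOverIso (map i)
  real : ∀ i (a : H.restr (c.U i)) (b : H.restr (c.U (c.bar i))), (b : H.Total) = H.τ a →
    (map (c.bar i) b : G.Total) = G.τ (map i a)

/-- `H` is obtained by gluing the groups `G_{U_i}` via the automorphisms `c.φ i j` of
`G_{U_i ∩ U_j}`. -/
def IsGluedBy (H : TwistorGroup.{u}) (c : G.autSheaf.Cocycle) : Prop :=
  ∃ t : G.Trivialization H c.cover, ∀ i j (a : H.Total) (hi : H.proj a ∈ c.cover.U i)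
    (hj : H.proj a ∈ c.cover.U j) (b : G.restr (c.cover.U i ⊓ c.cover.U j)),
    (b : G.Total) = t.map j ⟨a, hj⟩ → (t.map i ⟨a, hi⟩ : G.Total) = (c.φ i j).1 b

end TwistorGroup

section LieGroup

variable (E G : Type u) [NormedAddCommGroup E] [NormedSpace ℂ E]
  [TopologicalSpace G] [ChartedSpace E G]

instance instChartedSpaceProd : ChartedSpace (E × ℂ) (G × CP1) :=
  inferInstanceAs (ChartedSpace (ModelProd E ℂ) (G × CP1))

variable {E G} in
theorem contMDiff_lie_fst : ContMDiff 𝓘(ℂ, E × ℂ) 𝓘(ℂ, E) ω (Prod.fst : G × CP1 → G) := by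
  rw [modelWithCornersSelf_prod]
  exact contMDiff_fst (I := 𝓘(ℂ, E)) (J := 𝓘(ℂ))

variable {E G} in
theorem contMDiff_lie_snd : ContMDiff 𝓘(ℂ, E × ℂ) 𝓘(ℂ) ω (Prod.snd : G × CP1 → CP1) := by
  rw [modelWithCornersSelf_prod]
  exact contMDiff_snd (I := 𝓘(ℂ, E)) (J := 𝓘(ℂ))

variable {E G} in
theorem contMDiff_lie_mk {E' H' M' : Type*}
    [NormedAddCommGroup E'] [NormedSpace ℂ E'] [TopologicalSpace H'] [TopologicalSpace M']
    [ChartedSpace H' M'] {I : ModelWithCorners ℂ E' H'} {f : M' → G} {f' : M' → CP1}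
    (hf : ContMDiff I 𝓘(ℂ, E) ω f) (hf' : ContMDiff I 𝓘(ℂ) ω f') :
    ContMDiff I 𝓘(ℂ, E × ℂ) ω (fun x => (f x, f' x)) := by
  rw [modelWithCornersSelf_prod]
  exact hf.prodMk hf'

theorem mfderiv_lie_snd (a : G × CP1) :
    Function.Surjective (mfderiv 𝓘(ℂ, E × ℂ) 𝓘(ℂ) (Prod.snd : G × CP1 → CP1) a) := by
  have h : mfderiv 𝓘(ℂ, E × ℂ) 𝓘(ℂ) (Prod.snd : G × CP1 → CP1) a =
      ContinuousLinearMap.snd ℂ E ℂ := by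
    rw [modelWithCornersSelf_prod]
    exact mfderiv_snd (I := 𝓘(ℂ, E)) (I' := 𝓘(ℂ))
  rw [h]
  exact fun y => ⟨((0 : E), y), rfl⟩

variable [Group G] [LieGroup 𝓘(ℂ, E) ω G]

theorem isManifold_lie : IsManifold 𝓘(ℂ, E) ω G :=
  LieGroup.toContMDiffMul.toIsManifold

theorem isManifold_lie_prod : IsManifold 𝓘(ℂ, E × ℂ) ω (G × CP1) := by
  have := isManifold_lie E G
  rw [modelWithCornersSelf_prod]
  exact inferInstanceAs (IsManifold (𝓘(ℂ, E).prod 𝓘(ℂ)) ω (G × CP1))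

variable {E G}

/-- The trivial twistor group `G × ℂP¹` of a complex Lie group `G` with an antiholomorphic
involutive automorphism `s`; its real structure is `s` times the antipodal map. -/
def trivialTwistorGroup [FiniteDimensional ℂ E] [T2Space G] (s : G ≃* G)
    (hs : AntiHolomorphic E E s) (hss : ∀ g, s (s g) = g) : TwistorGroup.{u} where
  Model := E × ℂ
  Total := G × CP1
  isManifold := isManifold_lie_prod E G
  proj := Prod.snd
  contMDiff_proj := contMDiff_lie_snd
  submersion := mfderiv_lie_snd E G
  mul a b := (a.1 * b.1, a.2)
  one x := (1, x)
  inv a := (a.1⁻¹, a.2)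
  proj_mul _ _ _ := rfl
  proj_one _ := rfl
  proj_inv _ := rfl
  mul_assoc _ _ _ _ _ := Prod.ext (mul_assoc _ _ _) rfl
  one_mul _ := Prod.ext (one_mul _) rfl
  mul_one _ := Prod.ext (mul_one _) rfl
  inv_mul _ := Prod.ext (inv_mul_cancel _) rfl
  contMDiffOn_mul := by
    refine ContMDiff.contMDiffOn (contMDiff_lie_mk ?_ (contMDiff_lie_snd.comp contMDiff_fst))
    have : ContMDiffMul 𝓘(ℂ, E) ω G := LieGroup.toContMDiffMul
    exact (contMDiff_lie_fst.comp contMDiff_fst).mul (contMDiff_lie_fst.comp contMDiff_snd)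
  contMDiff_one := contMDiff_lie_mk contMDiff_const contMDiff_id
  contMDiff_inv := contMDiff_lie_mk (contMDiff_lie_fst.inv) contMDiff_lie_snd
  τ a := (s a.1, antipode a.2)
  antiHolomorphic_τ :=
    { continuous := (hs.continuous.comp continuous_fst).prodMk
        (continuous_antipode.comp continuous_snd)
      pullback := fun x h hh => by
        have := isManifold_lie E G
        rw [modelWithCornersSelf_prod] at hh ⊢
        exact hs.prodMap antiHolomorphic_antipode x h hh }
  τ_τ a := Prod.ext (hss a.1) (antipode_antipode a.2)
  proj_τ _ := rfl
  τ_mul a b _ := Prod.ext (map_mul s a.1 b.1) rfl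
  τ_one _ := Prod.ext (map_one s) rfl
  τ_inv a := Prod.ext (map_inv s a.1) rfl

variable (E G) in
/-- The group `𝒪(Aut G)(U)` of holomorphic maps `U → Aut(G)`: families of automorphisms of `G`
which, together with their inverses, depend holomorphically on the point of `U`, that is, are
holomorphic on `U × G`. -/
def autSections (U : Opens CP1) : Subgroup (U → MulAut G) where
  carrier := {f | ContMDiff (𝓘(ℂ).prod 𝓘(ℂ, E)) 𝓘(ℂ, E) ω (fun p : U × G => f p.1 p.2) ∧
    ContMDiff (𝓘(ℂ).prod 𝓘(ℂ, E)) 𝓘(ℂ, E) ω (fun p : U × G => (f p.1).symm p.2)}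
  mul_mem' hf hf' :=
    ⟨hf.1.comp (contMDiff_fst.prodMk hf'.1), hf'.2.comp (contMDiff_fst.prodMk hf.2)⟩
  one_mem' := ⟨contMDiff_snd, contMDiff_snd⟩
  inv_mem' hf := ⟨hf.2, hf.1⟩

/-- The antipodal map from the antipodal image of `U` to `U`. -/
def antipodeOn {U : Opens CP1} (x : antipodeOpens U) : U := ⟨antipode x, x.2⟩

theorem contMDiff_lie_conj [FiniteDimensional ℂ E] {s : G ≃* G} (hs : AntiHolomorphic E E s)
    {U : Opens CP1} {f : U → G → G}
    (hf : ContMDiff (𝓘(ℂ).prod 𝓘(ℂ, E)) 𝓘(ℂ, E) ω (fun p : U × G => f p.1 p.2)) :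
    ContMDiff (𝓘(ℂ).prod 𝓘(ℂ, E)) 𝓘(ℂ, E) ω
      (fun p : antipodeOpens U × G => s (f (antipodeOn p.1) (s p.2))) := by
  have := isManifold_lie E G
  have ha : AntiHolomorphic ℂ ℂ (antipodeOn (U := U)) :=
    antiHolomorphic_antipode.restrict (U := antipodeOpens U) (V := U) antipodeOn fun _ => rfl
  refine contMDiff_of_germs ?_ fun x h hh => ?_
  · exact hs.continuous.comp (hf.continuous.comp ((ha.continuous.comp continuous_fst).prodMk
      (hs.continuous.comp continuous_snd)))
  · have h1 := hs.pullback _ h hh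
    have h2 := ContMDiffAt.comp (g := fun y => conj (h (s y)))
      (f := fun p : U × G => f p.1 p.2) (antipodeOn x.1, s x.2) h1 hf.contMDiffAt
    simpa using ha.prodMap hs x _ h2

/-- The sheaf `𝒪(Aut G)` of holomorphic maps to `Aut(G)`; its real structure sends `f` to
`x ↦ s ∘ f(antipode x) ∘ s`. -/
def autValuedSheaf [FiniteDimensional ℂ E] (s : G ≃* G) (hs : AntiHolomorphic E E s)
    (hss : ∀ g, s (s g) = g) : RealGroupPresheaf.{u} where
  sec U := autSections E G U
  res {V U} h :=
    { toFun := fun f => ⟨fun x => f.1 ⟨x, h x.2⟩,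
        f.2.1.comp (((contMDiff_inclusion h).comp contMDiff_fst).prodMk contMDiff_snd),
        f.2.2.comp (((contMDiff_inclusion h).comp contMDiff_fst).prodMk contMDiff_snd)⟩
      map_one' := rfl
      map_mul' := fun _ _ => rfl }
  res_refl _ := rfl
  res_res _ _ _ := rfl
  conjSec {U} :=
    { toFun := fun f => ⟨fun x => (s.trans (f.1 (antipodeOn x))).trans s,
        contMDiff_lie_conj hs (f := fun y g => f.1 y g) f.2.1, by
          have hsymm (g : G) : s.symm g = s g := by rw [MulEquiv.symm_apply_eq, hss]
          refine (contMDiff_lie_conj hs (f := fun y g => (f.1 y).symm g) f.2.2).congr fun p => ?_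
          change s.symm ((f.1 (antipodeOn p.1)).symm (s.symm p.2)) = _
          rw [hsymm, hsymm]⟩
      map_one' := by
        apply Subtype.ext; ext x g
        exact hss g
      map_mul' := fun f f' => by
        apply Subtype.ext; ext x g
        change s (f.1 _ (f'.1 _ (s g))) = s (f.1 _ (s (s (f'.1 _ (s g)))))
        rw [hss] }
  conjSec_res _ _ := rfl
  conjSec_conjSec {U} f := by
    apply Subtype.ext; ext x g
    change s (s (f.1 ⟨antipode (antipode x), _⟩ (s (s g)))) = f.1 x g
    simp only [hss, antipode_antipode]

/-- `H` is obtained by gluing the trivial groups `G × U_i` via the maps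
`(g, x) ↦ (c.φ i j x g, x)` over `U_i ∩ U_j`. -/
def IsGluedByTransition [FiniteDimensional ℂ E] [T2Space G] {s : G ≃* G}
    {hs : AntiHolomorphic E E s} {hss : ∀ g, s (s g) = g} (H : TwistorGroup.{u})
    (c : (autValuedSheaf s hs hss).Cocycle) : Prop :=
  ∃ t : (trivialTwistorGroup s hs hss).Trivialization H c.cover,
    ∀ i j (a : H.Total) (hi : H.proj a ∈ c.cover.U i) (hj : H.proj a ∈ c.cover.U j),
      (t.map i ⟨a, hi⟩).1.1 = Subtype.val (p := (· ∈ autSections E G (c.cover.U i ⊓ c.cover.U j))) (c.φ i j)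
        ⟨H.proj a, hi, hj⟩ (t.map j ⟨a, hj⟩).1.1

end LieGroup

end Twistor

end

/-! Gluing behaves as descent. Call `H` glued by a cocycle `φ` if it has local isomorphisms `f i` to
`G` over the members of a real covering, equivariant for the real structures, with `f i = φ i j ∘ f
j`. This relation between groups and cocycles has six formal properties, and
`exists_bijective_of_gluing` shows that any relation with these properties induces the required
bijection.

A local form is glued by some cocycle (`exists_isGluedBy`): the local isomorphisms are made
equivariant by adjoining their conjugates over the antipodal neighbourhoods, and `φ i j = f i ∘ (f
j)⁻¹`. Two cocycles of one group are cohomologous (`cohomologous_of_isGluedBy`), through the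
comparison of the two families of local isomorphisms. A cohomologous cocycle glues the same group
(`isGluedBy_of_cohomologous`), since corrected local isomorphisms agree on overlaps and extend to
the members of the new covering. Two groups with the same cocycle are isomorphic
(`exists_isIso_of_isGluedBy`), since the composites of their local isomorphisms agree on overlaps.
Gluing data are transported along isomorphisms (`IsGluedBy.of_isIso`). Finally every cocycle glues
some group, `glued`. Its underlying set is that of `G`, each fibre being read in one chosen member
of the covering. The complex structure comes from the transition maps, and the real structure is
that of `G` corrected by the cocycle.

For a Lie group, a fibrewise automorphism of `G × U` over `U` is the same as a holomorphic family of
automorphisms of `G`. Hence `autIso` identifies the two sheaves with their real structures, and the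
second statement follows from the same six properties.

To avoid transport between subtypes over varying open sets, local isomorphisms are handled as maps
of whole total spaces with arbitrary values outside the relevant open set (`LocalIso`, `ev`). -/

namespace Twistor

/-! ### Local isomorphisms as maps of total spaces -/

namespace TwistorGroup

variable {G H K L : TwistorGroup.{u}} {U V : Opens CP1}

/-- The maps `f` and `g` restrict to mutually inverse isomorphisms over `U` between the parts of
`H` and `K` over `U`, as groups over `U`. Nothing is required outside these parts. -/
structure LocalIso (H K : TwistorGroup.{u}) (U : Opens CP1) (f : H.Total → K.Total)
    (g : K.Total → H.Total) : Prop where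
  proj : ∀ a, H.proj a ∈ U → K.proj (f a) = H.proj a
  proj_inv : ∀ b, K.proj b ∈ U → H.proj (g b) = K.proj b
  left_inv : ∀ a, H.proj a ∈ U → g (f a) = a
  right_inv : ∀ b, K.proj b ∈ U → f (g b) = b
  contMDiffOn : ContMDiffOn 𝓘(ℂ, H.Model) 𝓘(ℂ, K.Model) ω f (H.restr U)
  contMDiffOn_inv : ContMDiffOn 𝓘(ℂ, K.Model) 𝓘(ℂ, H.Model) ω g (K.restr U)
  map_mul : ∀ a b, H.proj a ∈ U → H.proj a = H.proj b → f (H.mul a b) = K.mul (f a) (f b)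

namespace LocalIso

variable {f f' : H.Total → K.Total} {g g' : K.Total → H.Total} {p : K.Total → L.Total}
  {q : L.Total → K.Total}

theorem symm (h : LocalIso H K U f g) : LocalIso K H U g f where
  proj := h.proj_inv
  proj_inv := h.proj
  left_inv := h.right_inv
  right_inv := h.left_inv
  contMDiffOn := h.contMDiffOn_inv
  contMDiffOn_inv := h.contMDiffOn
  map_mul a b ha hab := by
    have ha' := h.proj_inv a ha
    have hb' := h.proj_inv b (hab ▸ ha)
    have hab' : H.proj (g a) = H.proj (g b) := by rw [ha', hb', hab]
    have e := h.map_mul (g a) (g b) (ha'.symm ▸ ha) hab'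
    rw [h.right_inv a ha, h.right_inv b (hab ▸ ha)] at e
    rw [← e, h.left_inv]
    rwa [H.proj_mul _ _ hab', ha']

theorem trans (h : LocalIso H K U f g) (h' : LocalIso K L U p q) :
    LocalIso H L U (fun a => p (f a)) (fun b => g (q b)) where
  proj a ha := by rw [h'.proj _ (by rwa [h.proj a ha]), h.proj a ha]
  proj_inv b hb := by rw [h.proj_inv _ (by rwa [h'.proj_inv b hb]), h'.proj_inv b hb]
  left_inv a ha := by rw [h'.left_inv _ (by rwa [h.proj a ha]), h.left_inv a ha]
  right_inv b hb := by rw [h.right_inv _ (by rwa [h'.proj_inv b hb]), h'.right_inv b hb]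
  contMDiffOn := h'.contMDiffOn.comp h.contMDiffOn fun a ha => by
    change K.proj (f a) ∈ U; rw [h.proj a ha]; exact ha
  contMDiffOn_inv := h.contMDiffOn_inv.comp h'.contMDiffOn_inv fun b hb => by
    change K.proj (q b) ∈ U; rw [h'.proj_inv b hb]; exact hb
  map_mul a b ha hab := by
    rw [h.map_mul a b ha hab, h'.map_mul _ _ (by rwa [h.proj a ha])]
    rw [h.proj a ha, h.proj b (hab ▸ ha), hab]

theorem mono (h : LocalIso H K U f g) (hV : V ≤ U) : LocalIso H K V f g where
  proj a ha := h.proj a (hV ha)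
  proj_inv a ha := h.proj_inv a (hV ha)
  left_inv a ha := h.left_inv a (hV ha)
  right_inv a ha := h.right_inv a (hV ha)
  contMDiffOn := h.contMDiffOn.mono fun _ ha => hV ha
  contMDiffOn_inv := h.contMDiffOn_inv.mono fun _ ha => hV ha
  map_mul a b ha := h.map_mul a b (hV ha)

/-- The image of the identity is idempotent, and an idempotent in a fibre group is the identity.
Preservation of the identity is thus a consequence of multiplicativity. -/
theorem map_one (h : LocalIso H K U f g) {x : CP1} (hx : x ∈ U) : f (H.one x) = K.one x := by
  have h1 : H.mul (H.one x) (H.one x) = H.one x := by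
    have := H.one_mul (H.one x); rwa [H.proj_one] at this
  have hp : K.proj (f (H.one x)) = x := by rw [h.proj _ (by rwa [H.proj_one]), H.proj_one]
  have h2 := h.map_mul (H.one x) (H.one x) (by rwa [H.proj_one]) rfl
  rw [h1] at h2
  set e := f (H.one x)
  have h3 := K.mul_assoc (K.inv e) e e (K.proj_inv e) rfl
  rw [← h2, K.inv_mul, K.one_mul, hp] at h3
  exact h3

theorem map_inv (h : LocalIso H K U f g) {a : H.Total} (ha : H.proj a ∈ U) :
    f (H.inv a) = K.inv (f a) := by
  have h1 := h.map_mul (H.inv a) a (by rwa [H.proj_inv]) (H.proj_inv a)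
  rw [H.inv_mul, h.map_one ha] at h1
  have hp := h.proj a ha
  have hpi : K.proj (f (H.inv a)) = K.proj (f a) := by
    rw [h.proj _ (by rwa [H.proj_inv]), H.proj_inv, hp]
  -- The axioms contain only left inverses. With `d = c⁻¹`, associativity gives `c d = d⁻¹ d (c d) =
  -- d⁻¹ (d c) d = d⁻¹ d = 1`.
  have key (c : K.Total) : K.mul c (K.inv c) = K.one (K.proj c) := by
    set d := K.inv c with hd
    have hdp : K.proj d = K.proj c := K.proj_inv c
    have hdd : K.proj (K.inv d) = K.proj d := K.proj_inv d
    have e1 := K.one_mul (K.mul c d)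
    rw [K.proj_mul c d hdp.symm] at e1
    have e2 := K.inv_mul d
    rw [hdp] at e2
    rw [← e1, ← e2, K.mul_assoc _ _ _ hdd (by rw [K.proj_mul _ _ hdp.symm, hdp]),
      ← K.mul_assoc d c d hdp hdp.symm, hd, K.inv_mul, ← hd, ← hdp, K.one_mul]
  have h2 := K.mul_assoc (f (H.inv a)) (f a) (K.inv (f a)) hpi (K.proj_inv _).symm
  rw [← h1, key, ← hpi, K.mul_one] at h2
  have h3 := K.one_mul (K.inv (f a))
  rw [K.proj_inv, hp] at h3
  rw [← h2, h3]

/-- Being an isomorphism over `U` is local on `U`. -/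
theorem of_local
    (h : ∀ x ∈ U, ∃ V : Opens CP1, x ∈ V ∧ ∃ f' g', LocalIso H K V f' g' ∧
      (∀ a, H.proj a ∈ V → f a = f' a) ∧ ∀ b, K.proj b ∈ V → g b = g' b) :
    LocalIso H K U f g where
  proj a ha := by
    obtain ⟨V, hV, f', g', hl, hf, hg⟩ := h _ ha
    rw [hf a hV, hl.proj a hV]
  proj_inv a ha := by
    obtain ⟨V, hV, f', g', hl, hf, hg⟩ := h _ ha
    rw [hg a hV, hl.proj_inv a hV]
  left_inv a ha := by
    obtain ⟨V, hV, f', g', hl, hf, hg⟩ := h _ ha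
    rw [hf a hV, hg _ (by rwa [hl.proj a hV]), hl.left_inv a hV]
  right_inv a ha := by
    obtain ⟨V, hV, f', g', hl, hf, hg⟩ := h _ ha
    rw [hg a hV, hf _ (by rwa [hl.proj_inv a hV]), hl.right_inv a hV]
  contMDiffOn a ha := by
    obtain ⟨V, hV, f', g', hl, hf, hg⟩ := h _ ha
    have hn : (H.restr V : Set H.Total) ∈ 𝓝 a := (H.restr V).isOpen.mem_nhds hV
    refine ((hl.contMDiffOn.contMDiffAt hn).congr_of_eventuallyEq ?_).contMDiffWithinAt
    filter_upwards [hn] with b hb using hf b hb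
  contMDiffOn_inv a ha := by
    obtain ⟨V, hV, f', g', hl, hf, hg⟩ := h _ ha
    have hn : (K.restr V : Set K.Total) ∈ 𝓝 a := (K.restr V).isOpen.mem_nhds hV
    refine ((hl.contMDiffOn_inv.contMDiffAt hn).congr_of_eventuallyEq ?_).contMDiffWithinAt
    filter_upwards [hn] with b hb using hg b hb
  map_mul a b ha hab := by
    obtain ⟨V, hV, f', g', hl, hf, hg⟩ := h _ ha
    rw [hf a hV, hf b (hab ▸ hV), hf _ (by rwa [H.proj_mul a b hab]), hl.map_mul a b hV hab]

theorem eqOn_inv (h : LocalIso H K U f g) (h' : LocalIso H K U f' g')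
    (hf : ∀ a, H.proj a ∈ U → f a = f' a) {b : K.Total} (hb : K.proj b ∈ U) : g b = g' b := by
  have hb' : H.proj (g' b) ∈ U := by rwa [h'.proj_inv b hb]
  rw [← h.left_inv _ hb', hf _ hb', h'.right_inv b hb]

/-- Isomorphisms over the members of an open covering which agree on overlaps can be glued. -/
theorem exists_glue {ι : Type*} {W : ι → Opens CP1} {F : ι → H.Total → K.Total}
    {F' : ι → K.Total → H.Total} (h : ∀ k, LocalIso H K (W k) (F k) (F' k))
    (hF : ∀ k l a, H.proj a ∈ W k → H.proj a ∈ W l → F k a = F l a)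
    (hU : ∀ x ∈ U, ∃ k, x ∈ W k) :
    ∃ f g, LocalIso H K U f g ∧ ∀ k a, H.proj a ∈ U → H.proj a ∈ W k → f a = F k a := by
  classical
  -- Choosing an index for every point, including those outside `U`, needs a default index. Without
  -- any index `U` is empty and arbitrary maps do.
  rcases isEmpty_or_nonempty ι with hι | hι
  · have hn : ∀ x, x ∉ U := fun x hx => hι.elim (hU x hx).choose
    exact ⟨fun a => K.one (H.proj a), fun b => H.one (K.proj b),
      of_local fun x hx => absurd hx (hn x), fun k => hι.elim k⟩
  choose! k hk using hU
  -- Agreement of the inverses on overlaps is automatic, because the inverse of an isomorphism is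
  -- determined by it.
  have hF' : ∀ i j b, K.proj b ∈ W i → K.proj b ∈ W j → F' i b = F' j b := fun i j b hi hj =>
    eqOn_inv ((h i).mono inf_le_left) ((h j).mono inf_le_right)
      (fun a ha => hF i j a ha.1 ha.2) (U := W i ⊓ W j) ⟨hi, hj⟩
  refine ⟨fun a => F (k (H.proj a)) a, fun b => F' (k (K.proj b)) b, of_local fun x hx =>
    ⟨U ⊓ W (k x), ⟨hx, hk x hx⟩, F (k x), F' (k x), (h _).mono inf_le_right, ?_, ?_⟩, ?_⟩
  · exact fun a ha => hF _ _ a (hk _ ha.1) ha.2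
  · exact fun b hb => hF' _ _ b (hk _ hb.1) hb.2
  · exact fun i a ha hi => hF _ _ a (hk _ ha) hi

/-- The equivalence of the parts over `U` given by an isomorphism over `U`. -/
def toEquiv (h : LocalIso H K U f g) : H.restr U ≃ K.restr U where
  toFun a := ⟨f a, by rw [mem_restr, h.proj _ a.2]; exact a.2⟩
  invFun b := ⟨g b, by rw [mem_restr, h.proj_inv _ b.2]; exact b.2⟩
  left_inv a := Subtype.ext (h.left_inv _ a.2)
  right_inv b := Subtype.ext (h.right_inv b.1 b.2)

theorem isOverIso (h : LocalIso H K U f g) : IsOverIso h.toEquiv where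
  contMDiff := contMDiff_codRestrict (V := K.restr U) (f := h.toEquiv) fun a =>
    (contMDiffAt_subtype_iff (U := H.restr U) (f := f)).2
      (h.contMDiffOn.contMDiffAt ((H.restr U).isOpen.mem_nhds a.2))
  contMDiff_symm := contMDiff_codRestrict (V := H.restr U) (f := h.toEquiv.symm) fun a =>
    (contMDiffAt_subtype_iff (U := K.restr U) (f := g)).2
      (h.contMDiffOn_inv.contMDiffAt ((K.restr U).isOpen.mem_nhds a.2))
  proj a := h.proj _ a.2
  map_mul a _ hab := h.map_mul _ _ a.2 hab

end LocalIso

/-! ### From local isomorphisms to sections of the automorphism sheaf -/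

open Classical in
/-- Extension of a map over `U` to the whole total space, by the identity section outside. -/
noncomputable def extend (e : H.restr U → K.restr U) (a : H.Total) : K.Total :=
  if h : a ∈ H.restr U then e ⟨a, h⟩ else K.one (H.proj a)

theorem extend_of_mem (e : H.restr U → K.restr U) {a : H.Total} (ha : H.proj a ∈ U) :
    extend e a = e ⟨a, ha⟩ := dif_pos ha

theorem IsOverIso.contMDiffOn_extend {e : H.restr U → K.restr U}
    (he : ContMDiff 𝓘(ℂ, H.Model) 𝓘(ℂ, K.Model) ω e) :
    ContMDiffOn 𝓘(ℂ, H.Model) 𝓘(ℂ, K.Model) ω (extend e) (H.restr U) := fun a ha => by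
  have h1 : ContMDiffAt 𝓘(ℂ, H.Model) 𝓘(ℂ, K.Model) ω
      (fun x : H.restr U => extend e (x : H.Total)) ⟨a, ha⟩ := by
    refine ((contMDiff_subtype_val.comp he) ⟨a, ha⟩).congr_of_eventuallyEq
      (Eventually.of_forall fun x => ?_)
    exact extend_of_mem e x.2
  exact (contMDiffAt_subtype_iff.1 h1).contMDiffWithinAt

theorem IsOverIso.localIso {e : H.restr U ≃ K.restr U} (he : IsOverIso e) :
    LocalIso H K U (extend e) (extend e.symm) where
  proj a ha := by rw [extend_of_mem _ ha, he.proj]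
  proj_inv a ha := by rw [extend_of_mem _ ha, he.proj_symm]
  left_inv a ha := by
    rw [extend_of_mem _ ha, extend_of_mem _ (e ⟨a, ha⟩).2]; simp
  right_inv a ha := by
    rw [extend_of_mem _ ha, extend_of_mem _ (e.symm ⟨a, ha⟩).2]; simp
  contMDiffOn := contMDiffOn_extend he.contMDiff
  contMDiffOn_inv := contMDiffOn_extend he.contMDiff_symm
  map_mul a b ha hab := by
    have hb : H.proj b ∈ U := by rwa [← hab]
    rw [extend_of_mem _ ha, extend_of_mem _ hb,
      extend_of_mem (U := U) _ (by rwa [H.proj_mul a b hab])]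
    exact he.map_mul ⟨a, ha⟩ ⟨b, hb⟩ hab

/-- This lets global isomorphisms be produced by gluing over `⊤`, with compatibility with `τ`
checked separately. -/
theorem isIso_iff (e : H.Total ≃ K.Total) :
    IsIso H K e ↔ LocalIso H K ⊤ e e.symm ∧ ∀ a, e (H.τ a) = K.τ (e a) where
  mp h := ⟨{
    proj := fun a _ => h.proj a
    proj_inv := fun b _ => by rw [← h.proj, e.apply_symm_apply]
    left_inv := fun a _ => e.symm_apply_apply a
    right_inv := fun a _ => e.apply_symm_apply a
    contMDiffOn := h.contMDiff.contMDiffOn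
    contMDiffOn_inv := h.contMDiff_symm.contMDiffOn
    map_mul := fun a b _ => h.map_mul a b }, h.map_τ⟩
  mpr h := {
    contMDiff := contMDiffOn_univ.1 h.1.contMDiffOn
    contMDiff_symm := contMDiffOn_univ.1 h.1.contMDiffOn_inv
    proj := fun a => h.1.proj a trivial
    map_mul := fun a b => h.1.map_mul a b trivial
    map_τ := h.2 }

/-! ### Sections of the sheaf of automorphisms -/

/-- The permutation underlying a section of the sheaf of automorphisms. -/
def secPerm (e : G.autSheaf.sec U) : Equiv.Perm (G.restr U) :=
  Subtype.val (p := (· ∈ G.autGroup U)) e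

theorem isOverIso_secPerm (e : G.autSheaf.sec U) : IsOverIso (secPerm e) :=
  Subtype.property (p := (· ∈ G.autGroup U)) e

/-- A local automorphism of `G`, as a map of the total space. -/
noncomputable def ev (e : G.autSheaf.sec U) : G.Total → G.Total := extend (secPerm e)

theorem ev_of_mem (e : G.autSheaf.sec U) {a : G.Total} (ha : G.proj a ∈ U) :
    ev e a = secPerm e ⟨a, ha⟩ := extend_of_mem _ ha

theorem localIso_ev (e : G.autSheaf.sec U) : LocalIso G G U (ev e) (ev e⁻¹) :=
  (isOverIso_secPerm e).localIso

theorem proj_ev (e : G.autSheaf.sec U) {a : G.Total} (ha : G.proj a ∈ U) :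
    G.proj (ev e a) = G.proj a := (localIso_ev e).proj a ha

theorem ev_mul (e e' : G.autSheaf.sec U) {a : G.Total} (ha : G.proj a ∈ U) :
    ev (e * e') a = ev e (ev e' a) := by
  rw [ev_of_mem _ ha, ev_of_mem e (by rwa [proj_ev e' ha])]
  simp only [ev_of_mem e' ha]
  rfl

theorem ev_res (h : V ≤ U) (e : G.autSheaf.sec U) {a : G.Total} (ha : G.proj a ∈ V) :
    ev (G.autSheaf.res h e) a = ev e a := by
  rw [ev_of_mem _ ha, ev_of_mem _ (h ha)]; rfl

theorem ev_conjSec (e : G.autSheaf.sec U) {a : G.Total} (ha : G.proj a ∈ antipodeOpens U) :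
    ev (G.autSheaf.conjSec e) a = G.τ (ev e (G.τ a)) := by
  rw [ev_of_mem _ ha, ev_of_mem (U := U) _ (by rw [G.proj_τ]; exact ha)]; rfl

/-- Reduces identities between restricted, multiplied and conjugated sections to pointwise
identities of maps of `G.Total`; the cocycle and coboundary relations below are verified in this
way. -/
theorem sec_ext {e e' : G.autSheaf.sec U} (h : ∀ a, G.proj a ∈ U → ev e a = ev e' a) :
    e = e' := by
  refine Subtype.ext (Equiv.ext fun a => Subtype.ext ?_)
  have := h a a.2
  rwa [ev_of_mem _ a.2, ev_of_mem _ a.2] at this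

/-- The section of the sheaf of automorphisms given by an automorphism over `U`. -/
def LocalIso.toSec {f g : G.Total → G.Total} (h : LocalIso G G U f g) : G.autSheaf.sec U :=
  ⟨h.toEquiv, h.isOverIso⟩

theorem LocalIso.ev_toSec {f g : G.Total → G.Total} (h : LocalIso G G U f g) {a : G.Total}
    (ha : G.proj a ∈ U) : ev h.toSec a = f a := ev_of_mem _ ha

section Cocycle

variable (c : G.autSheaf.Cocycle) {a : G.Total} {i j k : c.cover.ι}

theorem ev_cocycle (hi : G.proj a ∈ c.cover.U i) (hj : G.proj a ∈ c.cover.U j)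
    (hk : G.proj a ∈ c.cover.U k) : ev (c.φ i j) (ev (c.φ j k) a) = ev (c.φ i k) a := by
  have ha : G.proj a ∈ c.cover.U i ⊓ c.cover.U j ⊓ c.cover.U k := ⟨⟨hi, hj⟩, hk⟩
  have h := congrArg (fun e => ev e a) (c.cocycle i j k)
  change ev _ a = ev _ a at h
  rw [ev_mul _ _ ha, ev_res _ _ ha, ev_res _ _ ha, ev_res] at h
  · exact h
  · have ha' : G.proj a ∈ c.cover.U j ⊓ c.cover.U k := ⟨hj, hk⟩
    rw [proj_ev _ ha']; exact ha

/-- The cocycle relation makes `φ i i` idempotent, and it is invertible. -/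
theorem ev_cocycle_self (hi : G.proj a ∈ c.cover.U i) : ev (c.φ i i) a = a := by
  have h := ev_cocycle c hi hi hi
  have hl := localIso_ev (c.φ i i)
  have hp := proj_ev (c.φ i i) (a := a) ⟨hi, hi⟩
  have h1 := congrArg (ev (c.φ i i)⁻¹) h
  rwa [hl.left_inv _ (by rw [hp]; exact ⟨hi, hi⟩), hl.left_inv a ⟨hi, hi⟩] at h1

theorem ev_real (hi : G.proj a ∈ c.cover.U (c.cover.bar i))
    (hj : G.proj a ∈ c.cover.U (c.cover.bar j)) :
    ev (c.φ (c.cover.bar i) (c.cover.bar j)) a = G.τ (ev (c.φ i j) (G.τ a)) := by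
  have ha : G.proj a ∈ c.cover.U (c.cover.bar i) ⊓ c.cover.U (c.cover.bar j) := ⟨hi, hj⟩
  rw [c.real]
  refine (ev_res _ (G.autSheaf.conjSec (c.φ i j)) ha).trans (ev_conjSec _ ?_)
  rw [c.cover.U_bar] at hi hj
  exact ⟨hi, hj⟩

end Cocycle

/-- Gluing of the parts of `G` via a cocycle, in terms of maps of the total spaces. -/
theorem isGluedBy_iff (c : G.autSheaf.Cocycle) : G.IsGluedBy H c ↔
    ∃ (f : c.cover.ι → H.Total → G.Total) (g : c.cover.ι → G.Total → H.Total),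
      (∀ i, LocalIso H G (c.cover.U i) (f i) (g i)) ∧
      (∀ i a, H.proj a ∈ c.cover.U i → f (c.cover.bar i) (H.τ a) = G.τ (f i a)) ∧
      ∀ i j a, H.proj a ∈ c.cover.U i → H.proj a ∈ c.cover.U j →
        f i a = ev (c.φ i j) (f j a) := by
  have hbar {i : c.cover.ι} {a : H.Total} (ha : H.proj a ∈ c.cover.U i) :
      H.proj (H.τ a) ∈ c.cover.U (c.cover.bar i) := by
    rw [c.cover.U_bar, H.proj_τ]; exact antipode_mem ha
  constructor
  · rintro ⟨t, ht⟩
    refine ⟨fun i => extend (t.map i), fun i => extend (t.map i).symm,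
      fun i => (t.isOverIso i).localIso, fun i a ha => ?_, fun i j a hi hj => ?_⟩
    · beta_reduce
      rw [extend_of_mem _ ha, extend_of_mem _ (hbar ha)]
      exact t.real i ⟨a, ha⟩ ⟨H.τ a, hbar ha⟩ rfl
    · have hp : G.proj (t.map j ⟨a, hj⟩) = H.proj a := (t.isOverIso j).proj ⟨a, hj⟩
      beta_reduce
      rw [extend_of_mem _ hi, extend_of_mem _ hj, ev_of_mem _ (by rw [hp]; exact ⟨hi, hj⟩)]
      exact ht i j a hi hj ⟨_, by rw [mem_restr, hp]; exact ⟨hi, hj⟩⟩ rfl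
  · rintro ⟨f, g, h, hr, hg⟩
    refine ⟨⟨fun i => (h i).toEquiv, fun i => (h i).isOverIso, fun i a b hab => ?_⟩,
      fun i j a hi hj b hb => ?_⟩
    · change f _ b = G.τ (f i a)
      rw [hab, hr i a a.2]
    · change f i a = _
      rw [hg i j a hi hj]
      change b.1 = f j a at hb
      rw [← hb]
      exact ev_of_mem _ b.2

end TwistorGroup

end Twistor

/-! ### Real coverings, and gluing compared with cohomology -/

namespace Twistor

theorem RealCover.antipode_mem (W : RealCover) {x : CP1} {k : W.ι} (hx : x ∈ W.U k) :
    antipode x ∈ W.U (W.bar k) := by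
  rw [W.U_bar]; exact Twistor.antipode_mem hx

/-- The common refinement of two real coverings. -/
noncomputable def RealCover.inf (c d : RealCover) : RealCover where
  ι := c.ι × d.ι
  U k := c.U k.1 ⊓ d.U k.2
  covers x := by
    obtain ⟨i, hi⟩ := c.covers x
    obtain ⟨j, hj⟩ := d.covers x
    exact ⟨(i, j), hi, hj⟩
  bar k := (c.bar k.1, d.bar k.2)
  bar_bar k := Prod.ext (c.bar_bar _) (d.bar_bar _)
  U_bar k := by rw [c.U_bar, d.U_bar]; rfl

/-- The real covering generated by a family of neighbourhoods of all points. -/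
noncomputable def RealCover.ofNhds (U : CP1 → Opens CP1) (hU : ∀ x, x ∈ U x) : RealCover where
  ι := CP1 × Bool
  U k := bif k.2 then antipodeOpens (U k.1) else U k.1
  covers x := ⟨(x, false), hU x⟩
  bar k := (k.1, !k.2)
  bar_bar k := Prod.ext rfl (Bool.not_not _)
  U_bar k := by
    rcases k with ⟨x, _ | _⟩
    · rfl
    · refine Opens.ext (Set.ext fun y => ?_)
      change y ∈ U x ↔ antipode (antipode y) ∈ U x
      rw [antipode_antipode]

namespace RealGroupPresheaf

variable {F : RealGroupPresheaf.{u}}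

/-- The inverse cochain works on the same refinement. Transitivity is not needed: the quotient is by
the generated equivalence relation, and being glued is invariant along chains of relations. -/
theorem Cohomologous.symm {c d : F.Cocycle} (h : Cohomologous c d) : Cohomologous d c := by
  obtain ⟨W, r, s, hr, hs, a, h1, h2, h3, h4⟩ := h
  refine ⟨W, s, r, hs, hr, fun k => (a k)⁻¹, h2, h1, fun k => ?_, fun k l => ?_⟩
  · beta_reduce
    rw [h3, map_inv, map_inv]
  · rw [h4, map_inv, map_inv]
    group

end RealGroupPresheaf

open RealGroupPresheaf

namespace TwistorGroup

variable {G H K : TwistorGroup.{u}}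

/-- If `f` and `p` are the two families of local isomorphisms of `H`, the cochain on the
intersections is `λ (i, j) = p j ∘ (f i)⁻¹`. It is real because both families are equivariant, and
in `λ φ λ⁻¹` the maps `f` cancel, leaving the transition maps of `p`. -/
theorem cohomologous_of_isGluedBy {c d : G.autSheaf.Cocycle} (hc : G.IsGluedBy H c)
    (hd : G.IsGluedBy H d) : Cohomologous c d := by
  obtain ⟨f, g, hf, hfr, hfc⟩ := (isGluedBy_iff c).1 hc
  obtain ⟨p, q, hp, hpr, hpd⟩ := (isGluedBy_iff d).1 hd
  have hl (k : (c.cover.inf d.cover).ι) : LocalIso G G ((c.cover.inf d.cover).U k)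
      (fun a => p k.2 (g k.1 a)) (fun a => f k.1 (q k.2 a)) :=
    ((hf k.1).symm.mono inf_le_left).trans ((hp k.2).mono inf_le_right)
  -- The gluing relation in inverse form: `(f i)⁻¹ ∘ φ i i' = (f i')⁻¹`.
  have key {i i' : c.cover.ι} {a : G.Total} (hi : G.proj a ∈ c.cover.U i)
      (hi' : G.proj a ∈ c.cover.U i') : g i (ev (c.φ i i') a) = g i' a := by
    have h1 : H.proj (g i' a) = G.proj a := (hf i').proj_inv a hi'
    have h2 := hfc i i' (g i' a) (by rwa [h1]) (by rwa [h1])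
    rw [(hf i').right_inv a hi'] at h2
    rw [← h2, (hf i).left_inv _ (by rwa [h1])]
  refine ⟨c.cover.inf d.cover, Prod.fst, Prod.snd, fun k => inf_le_left, fun k => inf_le_right,
    fun k => (hl k).toSec, fun k => rfl, fun k => rfl, fun k => sec_ext fun a ha => ?_,
    fun k l => eq_mul_inv_iff_mul_eq.2 (sec_ext fun a ha => ?_)⟩
  · have ha' := ha
    rw [RealCover.U_bar] at ha'
    have h0 : G.proj (G.τ a) ∈ (c.cover.inf d.cover).U k := by rwa [G.proj_τ]
    have h1 : H.proj (g k.1 (G.τ a)) = G.proj (G.τ a) := (hf k.1).proj_inv _ h0.1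
    have h2 := hfr k.1 (g k.1 (G.τ a)) (by rw [h1]; exact h0.1)
    rw [(hf k.1).right_inv _ h0.1, G.τ_τ] at h2
    have h3 := (hf (c.cover.bar k.1)).left_inv (H.τ (g k.1 (G.τ a)))
      (by rw [H.proj_τ, h1]; exact c.cover.antipode_mem h0.1)
    rw [h2] at h3
    rw [(hl _).ev_toSec ha, ev_res _ _ ha, ev_conjSec _ ha', (hl k).ev_toSec h0]
    change p (d.cover.bar k.2) (g (c.cover.bar k.1) a) = _
    rw [h3, hpr _ _ (by rw [h1]; exact h0.2)]
  · have hk := ha.1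
    have hl' := ha.2
    have h1 : H.proj (g l.1 a) = G.proj a := (hf l.1).proj_inv a hl'.1
    have h2 : G.proj (ev (hl l).toSec a) = G.proj a := proj_ev _ hl'
    have h3 : G.proj (ev (c.φ k.1 l.1) a) = G.proj a := proj_ev _ ⟨hk.1, hl'.1⟩
    rw [ev_mul _ _ ha, ev_mul _ _ ha, ev_res _ _ ha, ev_res _ _ ha, ev_res _ (d.φ k.2 l.2),
      ev_res, (hl l).ev_toSec hl', (hl k).ev_toSec, key hk.1 hl'.1, ← hpd]
    · rw [h1]; exact hk.2
    · rw [h1]; exact hl'.2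
    · rw [h3]; exact hk
    · rw [h3]; exact ha
    · rw [h2]; exact ha

/-- Write `ψ` for the cocycle `d`. On the refinement, `t k ∘ f (r k)` has transition maps `ψ`. To
get an isomorphism over a whole member `j` of the covering of `d`, transport it to `ψ j (s k) ∘ t k
∘ f (r k)` on `W k ∩ U j`. The coboundary and cocycle relations make this independent of `k`, so the
pieces glue. Equivariance and the relation with `ψ` may be checked on each piece. -/
theorem isGluedBy_of_cohomologous {c d : G.autSheaf.Cocycle} (h : Cohomologous c d)
    (hc : G.IsGluedBy H c) : G.IsGluedBy H d := by
  obtain ⟨W, r, s, hr, hs, t, hrb, hsb, htb, htc⟩ := h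
  obtain ⟨f, g, hf, hfr, hfc⟩ := (isGluedBy_iff c).1 hc
  have hproj {k : W.ι} {a : H.Total} (hk : H.proj a ∈ W.U k) :
      G.proj (f (r k) a) = H.proj a := (hf (r k)).proj a (hr k hk)
  have hproj' {k : W.ι} {a : H.Total} (hk : H.proj a ∈ W.U k) :
      G.proj (ev (t k) (f (r k) a)) = H.proj a := by
    rw [proj_ev _ (by rwa [hproj hk]), hproj hk]
  have htb' {k : W.ι} {a : G.Total} (ha : G.proj a ∈ W.U k) :
      ev (t (W.bar k)) (G.τ a) = G.τ (ev (t k) a) := by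
    have h1 : G.proj (G.τ a) ∈ W.U (W.bar k) := by rw [G.proj_τ]; exact W.antipode_mem ha
    have h2 := h1
    rw [W.U_bar] at h2
    rw [htb, ev_res _ _ h1, ev_conjSec _ h2, G.τ_τ]
  -- The coboundary relation without inverses: `ψ ∘ t l = t k ∘ φ`.
  have htc' {k l : W.ι} {a : G.Total} (hk : G.proj a ∈ W.U k) (hl : G.proj a ∈ W.U l) :
      ev (d.φ (s k) (s l)) (ev (t l) a) = ev (t k) (ev (c.φ (r k) (r l)) a) := by
    have ha : G.proj a ∈ W.U k ⊓ W.U l := ⟨hk, hl⟩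
    have h1 := congrArg (fun e => ev e a) (eq_mul_inv_iff_mul_eq.1 (htc k l))
    change ev _ a = ev _ a at h1
    have h2 : G.proj (ev (t l) a) = G.proj a := proj_ev _ hl
    have h3 : G.proj (ev (c.φ (r k) (r l)) a) = G.proj a := proj_ev _ ⟨hr k hk, hr l hl⟩
    rw [ev_mul _ _ ha, ev_mul _ _ ha, ev_res _ _ ha, ev_res _ _ ha, ev_res, ev_res] at h1
    · exact h1
    · rw [h3]; exact ha
    · rw [h2]; exact ha
  have hF (j : d.cover.ι) (k : W.ι) : LocalIso H G (W.U k ⊓ d.cover.U j)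
      (fun a => ev (d.φ j (s k)) (ev (t k) (f (r k) a)))
      (fun a => g (r k) (ev (t k)⁻¹ (ev (d.φ j (s k))⁻¹ a))) :=
    (((hf (r k)).mono (inf_le_left.trans (hr k))).trans
      ((localIso_ev (t k)).mono inf_le_left)).trans
      ((localIso_ev (d.φ j (s k))).mono (le_inf inf_le_right (inf_le_left.trans (hs k))))
  have hglue (j : d.cover.ι) := LocalIso.exists_glue (U := d.cover.U j) (hF j)
    (fun k l a hk hl => by
      have hk1 := hk.1
      have hl1 := hl.1
      have e1 := htc' (k := k) (l := l) (a := f (r l) a)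
        (by rwa [hproj hl1]) (by rwa [hproj hl1])
      rw [← hfc (r k) (r l) a (hr k hk1) (hr l hl1)] at e1
      rw [← e1, ev_cocycle]
      all_goals rw [hproj' hl1]
      exacts [hk.2, hs k hk1, hs l hl1])
    (fun x hx => (W.covers x).imp fun k hk => ⟨hk, hx⟩)
  choose p q hp hpF using hglue
  refine (isGluedBy_iff d).2 ⟨p, q, hp, fun j a ha => ?_, fun i j a hi hj => ?_⟩
  · obtain ⟨k, hk⟩ := W.covers (H.proj a)
    have ha' : H.proj (H.τ a) ∈ d.cover.U (d.cover.bar j) := by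
      rw [H.proj_τ]; exact d.cover.antipode_mem ha
    have hk' : H.proj (H.τ a) ∈ W.U (W.bar k) := by
      rw [H.proj_τ]; exact W.antipode_mem hk
    rw [hpF j k a ha ⟨hk, ha⟩, hpF _ (W.bar k) _ ha' ⟨hk', ha'⟩, hrb, hsb, hfr _ _ (hr k hk),
      htb' (by rwa [hproj hk]), ev_real, G.τ_τ]
    all_goals rw [G.proj_τ, hproj' hk]
    · exact d.cover.antipode_mem ha
    · exact d.cover.antipode_mem (hs k hk)
  · obtain ⟨k, hk⟩ := W.covers (H.proj a)
    rw [hpF j k a hj ⟨hk, hj⟩, hpF i k a hi ⟨hk, hi⟩, ev_cocycle]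
    all_goals rw [hproj' hk]
    exacts [hi, hj, hs k hk]

/-- The composites `(p i)⁻¹ ∘ f i` of the local isomorphisms of `H` and `K` agree on overlaps, since
the common `φ i j` cancels. They commute with `τ` because both families are equivariant. -/
theorem exists_isIso_of_isGluedBy {c : G.autSheaf.Cocycle} (hH : G.IsGluedBy H c)
    (hK : G.IsGluedBy K c) : ∃ e : H.Total ≃ K.Total, IsIso H K e := by
  obtain ⟨f, g, hf, hfr, hfc⟩ := (isGluedBy_iff c).1 hH
  obtain ⟨p, q, hp, hpr, hpc⟩ := (isGluedBy_iff c).1 hK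
  obtain ⟨e, e', he, heF⟩ := LocalIso.exists_glue (U := ⊤)
    (fun i => (hf i).trans (hp i).symm) (fun i j a hi hj => by
      have h1 : G.proj (f j a) = H.proj a := (hf j).proj a hj
      have h2 : K.proj (q j (f j a)) = H.proj a := by rw [(hp j).proj_inv _ (by rwa [h1]), h1]
      have h3 := hpc i j (q j (f j a)) (by rwa [h2]) (by rwa [h2])
      rw [(hp j).right_inv _ (by rwa [h1])] at h3
      rw [hfc i j a hi hj, ← h3, (hp i).left_inv _ (by rwa [h2])])
    (fun x _ => c.cover.covers x)
  refine ⟨⟨e, e', fun a => he.left_inv a trivial, fun a => he.right_inv a trivial⟩,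
    (isIso_iff _).2 ⟨he, fun a => ?_⟩⟩
  obtain ⟨i, hi⟩ := c.cover.covers (H.proj a)
  have hi' : H.proj (H.τ a) ∈ c.cover.U (c.cover.bar i) := by
    rw [H.proj_τ]; exact c.cover.antipode_mem hi
  change e (H.τ a) = K.τ (e a)
  have h1 : G.proj (f i a) = H.proj a := (hf i).proj a hi
  have h2 : K.proj (q i (f i a)) = H.proj a := by rw [(hp i).proj_inv _ (by rwa [h1]), h1]
  have h3 := hpr i (q i (f i a)) (by rwa [h2])
  rw [(hp i).right_inv _ (by rwa [h1])] at h3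
  rw [heF i a trivial hi, heF _ _ trivial hi', hfr i a hi, ← h3, (hp _).left_inv]
  rw [K.proj_τ, h2]
  exact c.cover.antipode_mem hi

theorem IsGluedBy.of_isIso {c : G.autSheaf.Cocycle} (hH : G.IsGluedBy H c)
    {e : H.Total ≃ K.Total} (he : IsIso H K e) : G.IsGluedBy K c := by
  obtain ⟨f, g, hf, hfr, hfc⟩ := (isGluedBy_iff c).1 hH
  obtain ⟨he, her⟩ := (isIso_iff e).1 he
  have hp (a : K.Total) : H.proj (e.symm a) = K.proj a := he.proj_inv a trivial
  refine (isGluedBy_iff c).2 ⟨fun i a => f i (e.symm a), fun i a => e (g i a),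
    fun i => (he.symm.mono le_top).trans (hf i), fun i a ha => ?_, fun i j a hi hj => ?_⟩
  · have h1 : e.symm (K.τ a) = H.τ (e.symm a) := by
      rw [Equiv.symm_apply_eq, her, e.apply_symm_apply]
    beta_reduce
    rw [h1, hfr _ _ (by rwa [hp])]
  · exact hfc i j _ (by rwa [hp]) (by rwa [hp])

theorem extend_overConj {U : Opens CP1} (e : H.restr U ≃ K.restr U) {a : H.Total}
    (ha : H.proj a ∈ antipodeOpens U) : extend (overConj e) a = K.τ (extend e (H.τ a)) := by
  rw [extend_of_mem _ ha, extend_of_mem (U := U) _ (by rw [H.proj_τ]; exact ha)]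
  rfl

/-- The transition functions of an equivariant family of local isomorphisms. -/
theorem exists_isGluedBy_of_localIso {W : RealCover} {f : W.ι → H.Total → G.Total}
    {g : W.ι → G.Total → H.Total} (h : ∀ i, LocalIso H G (W.U i) (f i) (g i))
    (hτ : ∀ i a, H.proj a ∈ W.U i → f (W.bar i) (H.τ a) = G.τ (f i a)) :
    ∃ c : G.autSheaf.Cocycle, G.IsGluedBy H c := by
  have hl (i j : W.ι) : LocalIso G G (W.U i ⊓ W.U j)
      (fun a => f i (g j a)) (fun a => f j (g i a)) :=
    ((h j).symm.mono inf_le_right).trans ((h i).mono inf_le_left)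
  have hg {i : W.ι} {a : G.Total} (hi : G.proj a ∈ W.U i) : H.proj (g i a) = G.proj a :=
    (h i).proj_inv a hi
  refine ⟨⟨W, fun i j => (hl i j).toSec, fun i j k => sec_ext fun a ha => ?_,
    fun i j => sec_ext fun a ha => ?_⟩,
    (isGluedBy_iff _).2 ⟨f, g, h, hτ, fun i j a hi hj => ?_⟩⟩
  · have hi : G.proj a ∈ W.U i := ha.1.1
    have hj : G.proj a ∈ W.U j := ha.1.2
    have hk : G.proj a ∈ W.U k := ha.2
    have hp : G.proj (f j (g k a)) = G.proj a := (hl j k).proj a ⟨hj, hk⟩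
    rw [ev_mul _ _ ha, ev_res _ _ ha, ev_res _ _ ha, ev_res,
      (hl j k).ev_toSec ⟨hj, hk⟩, (hl i k).ev_toSec ⟨hi, hk⟩, (hl i j).ev_toSec,
      (h j).left_inv _ (by rwa [hg hk])]
    · rw [hp]; exact ⟨hi, hj⟩
    · rw [(hl j k).ev_toSec ⟨hj, hk⟩, hp]; exact ha
  · have ha' : G.proj a ∈ antipodeOpens (W.U i ⊓ W.U j) := by
      have ha' := ha
      rw [W.U_bar, W.U_bar] at ha'
      exact ha'
    have h0 : G.proj (G.τ a) ∈ W.U i ⊓ W.U j := by rwa [G.proj_τ]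
    refine ((hl _ _).ev_toSec ha).trans (Eq.symm ((ev_res _ _ ha).trans ?_))
    refine (ev_conjSec _ ha').trans ?_
    rw [(hl i j).ev_toSec h0, ← hτ i _ (by rw [hg h0.2]; exact h0.1)]
    -- What remains is that the inverses `g` are equivariant too: `g (bar j) a = τ (g j (τ a))`.
    congr 1
    have h1 := (h (W.bar j)).left_inv (H.τ (g j (G.τ a)))
      (by rw [H.proj_τ, hg h0.2]; exact W.antipode_mem h0.2)
    rw [hτ j _ (by rw [hg h0.2]; exact h0.2), (h j).right_inv _ h0.2, G.τ_τ] at h1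
    exact h1.symm
  · have hp : G.proj (f j a) = H.proj a := (h j).proj a hj
    rw [(hl i j).ev_toSec (by rw [hp]; exact ⟨hi, hj⟩), (h j).left_inv _ hj]

/-- The given local isomorphisms need not respect `τ`. Each neighbourhood is therefore paired with
its antipodal image, over which the conjugate `τ ∘ e ∘ τ` is used, and the family becomes
equivariant by construction. The involution on the indices has no fixed element, so no isomorphism
is required to be its own conjugate. -/
theorem exists_isGluedBy (hH : G.LocallyIso H) : ∃ c : G.autSheaf.Cocycle, G.IsGluedBy H c := by
  choose U hU e he using hH
  have hE : ∀ k : (RealCover.ofNhds U hU).ι,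
      ∃ e' : H.restr ((RealCover.ofNhds U hU).U k) ≃ G.restr ((RealCover.ofNhds U hU).U k),
        IsOverIso e' ∧ ∀ a, H.proj a ∈ (RealCover.ofNhds U hU).U k →
          extend e' a = bif k.2 then G.τ (extend (e k.1) (H.τ a)) else extend (e k.1) a := by
    rintro ⟨x, _ | _⟩
    · exact ⟨e x, he x, fun a _ => rfl⟩
    · exact ⟨overConj (e x), (he x).isOverIso_overConj, fun a ha => extend_overConj (e x) ha⟩
  choose e' he' hee using hE
  refine exists_isGluedBy_of_localIso (fun k => (he' k).localIso) fun k a ha => ?_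
  have ha' : H.proj (H.τ a) ∈ (RealCover.ofNhds U hU).U ((RealCover.ofNhds U hU).bar k) := by
    rw [H.proj_τ]; exact RealCover.antipode_mem _ ha
  rw [hee _ _ ha, hee _ _ ha']
  rcases k with ⟨x, _ | _⟩
  · change G.τ (extend (e x) (H.τ (H.τ a))) = G.τ (extend (e x) a)
    rw [H.τ_τ]
  · change extend (e x) (H.τ a) = G.τ (G.τ (extend (e x) (H.τ a)))
    rw [G.τ_τ]

theorem locallyIso_of_isGluedBy {c : G.autSheaf.Cocycle} (h : G.IsGluedBy H c) :
    G.LocallyIso H := fun x => by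
  obtain ⟨i, hi⟩ := c.cover.covers x
  obtain ⟨t, -⟩ := h
  exact ⟨_, hi, t.map i, t.isOverIso i⟩

/-- A relation between local forms and cocycles which enjoys the formal properties of gluing
induces a bijection from isomorphism classes to cohomology classes. -/
theorem exists_bijective_of_gluing {F : RealGroupPresheaf.{u}}
    (R : TwistorGroup.{u} → F.Cocycle → Prop)
    (hex : ∀ H, G.LocallyIso H → ∃ c, R H c)
    (hex' : ∀ c, ∃ H, G.LocallyIso H ∧ R H c)
    (hcoh : ∀ {H c d}, R H c → R H d → Cohomologous c d)
    (htrans : ∀ {H c d}, Cohomologous c d → R H c → R H d)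
    (hiso : ∀ {H K c}, R H c → R K c → ∃ e : H.Total ≃ K.Total, IsIso H K e)
    (htrans' : ∀ {H K c} {e : H.Total ≃ K.Total}, IsIso H K e → R H c → R K c) :
    ∃ f : G.LocalForms → F.H1R, Function.Bijective f ∧
      ∀ (H : {H : TwistorGroup.{u} // G.LocallyIso H}) (c : F.Cocycle),
        f (Quot.mk _ H) = Quot.mk _ c ↔ R H.1 c := by
  choose γ hγ using fun H : {H : TwistorGroup.{u} // G.LocallyIso H} => hex H.1 H.2
  -- Equality of classes only provides a chain of cohomologous cocycles and their reverses; `R H` is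
  -- carried along each link.
  have hclass {c d : F.Cocycle} (h : (Quot.mk _ c : F.H1R) = Quot.mk _ d) (H : TwistorGroup.{u}) :
      R H c ↔ R H d := by
    have h' := Quot.eqvGen_exact h
    clear h
    induction h' with
    | rel c d h => exact ⟨htrans h, htrans h.symm⟩
    | refl => rfl
    | symm c d h ih => exact ih.symm
    | trans c d e h h' ih ih' => exact ih.trans ih'
  let f : G.LocalForms → F.H1R := Quot.lift (fun H => Quot.mk _ (γ H)) fun H K ⟨e, he⟩ =>
    Quot.sound (hcoh (htrans' he (hγ H)) (hγ K))
  have hf (H : {H : TwistorGroup.{u} // G.LocallyIso H}) (c : F.Cocycle) :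
      f (Quot.mk _ H) = Quot.mk _ c ↔ R H.1 c :=
    ⟨fun h => (hclass h H.1).1 (hγ H), fun h => Quot.sound (hcoh (hγ H) h)⟩
  refine ⟨f, ⟨?_, ?_⟩, hf⟩
  · rintro ⟨H⟩ ⟨K⟩ h
    -- Equality of the classes says that `H` too is glued by the cocycle chosen for `K`.
    exact Quot.sound (hiso ((hf H _).1 h) (hγ K))
  · rintro ⟨c⟩
    obtain ⟨H, hH, h⟩ := hex' c
    exact ⟨Quot.mk _ ⟨H, hH⟩, (hf _ _).2 h⟩

end TwistorGroup

end Twistor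

/-! ### Gluing complex manifolds from partial bijections -/

namespace Twistor

section GluingManifolds

variable {E M N ι : Type*} [NormedAddCommGroup E] [NormedSpace ℂ E] [TopologicalSpace M]
  [ChartedSpace E M]

/-- A set covered by the domains of partial bijections to a complex manifold `M` whose transition
maps are holomorphic on open sets. -/
structure ManifoldGluing (E M N ι : Type*) [NormedAddCommGroup E] [NormedSpace ℂ E]
    [TopologicalSpace M] [ChartedSpace E M] where
  part : ι → PartialEquiv N M
  idx : N → ι
  mem_source : ∀ x, x ∈ (part (idx x)).source
  isOpen_source : ∀ i j, IsOpen ((part i).symm.trans (part j)).source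
  contMDiffOn : ∀ i j, ContMDiffOn 𝓘(ℂ, E) 𝓘(ℂ, E) ω ((part i).symm.trans (part j))
    ((part i).symm.trans (part j)).source

namespace ManifoldGluing

variable (D : ManifoldGluing E M N ι)

/-- Here `M` itself plays the role of the model space. This gives `N` the topology in which every
`part i` is an open partial homeomorphism; charts in `E` come afterwards, by composing with those of
`M`. -/
def core : ChartedSpaceCore M N where
  atlas := range D.part
  chartAt x := D.part (D.idx x)
  mem_chart_source := D.mem_source
  chart_mem_atlas x := mem_range_self _
  open_source := by rintro _ _ ⟨i, rfl⟩ ⟨j, rfl⟩; exact D.isOpen_source i j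
  continuousOn_toFun := by rintro _ _ ⟨i, rfl⟩ ⟨j, rfl⟩; exact (D.contMDiffOn i j).continuousOn

@[reducible] def topologicalSpace : TopologicalSpace N := D.core.toTopologicalSpace

/-- The partial bijections as partial homeomorphisms. -/
def homeo (i : ι) : @OpenPartialHomeomorph N M D.topologicalSpace _ :=
  D.core.openPartialHomeomorph (D.part i) (mem_range_self i)

@[reducible] noncomputable def chartedSpace : @ChartedSpace E _ N D.topologicalSpace :=
  letI := D.topologicalSpace
  { atlas := {e | ∃ i, ∃ e' ∈ atlas E M, e = (D.homeo i).trans e'}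
    chartAt := fun x => (D.homeo (D.idx x)).trans (chartAt E (D.part (D.idx x) x))
    mem_chart_source := fun x => by
      rw [OpenPartialHomeomorph.trans_source]
      exact ⟨D.mem_source x, mem_chart_source E _⟩
    chart_mem_atlas := fun x => ⟨_, _, chart_mem_atlas E _, rfl⟩ }

/-- A change of coordinates on `N` is an inverse chart of `M`, followed by a transition map of the
gluing, followed by a chart of `M`. -/
theorem isManifold [IsManifold 𝓘(ℂ, E) ω M] :
    @IsManifold ℂ _ E _ _ E _ 𝓘(ℂ, E) ω N D.topologicalSpace D.chartedSpace := by
  let := D.topologicalSpace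
  let := D.chartedSpace
  apply isManifold_of_contDiffOn
  rintro _ _ ⟨i, e, he, rfl⟩ ⟨j, e', he', rfl⟩
  simp only [modelWithCornersSelf_coe, modelWithCornersSelf_coe_symm, Function.comp_id,
    Function.id_comp, range_id, inter_univ, preimage_id]
  refine contMDiffOn_iff_contDiffOn.1 fun z hz => ?_
  obtain ⟨⟨hz1, hz2⟩, hz3, hz4⟩ := hz
  have h2 := (contMDiffOn_symm_of_mem_maximalAtlas (I := 𝓘(ℂ, E)) (n := ω)
    (IsManifold.subset_maximalAtlas he)).contMDiffAt (e.open_target.mem_nhds hz1)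
  have h0 := (D.contMDiffOn i j).contMDiffAt ((D.isOpen_source i j).mem_nhds ⟨hz2, hz3⟩)
  have h1 := contMDiffAt_of_mem_maximalAtlas (I := 𝓘(ℂ, E)) (n := ω)
    (IsManifold.subset_maximalAtlas he') hz4
  exact ((h1.comp (e.symm z) h0).comp z h2).contMDiffWithinAt

variable [IsManifold 𝓘(ℂ, E) ω M]

/-- For a chart `e` of `M`, the composite `e ∘ part i` is a chart of `N`, and near a point `part i`
is `e⁻¹` after it. The inverse is treated in the same way. -/
theorem contMDiffOn_homeo (i : ι) :
    @ContMDiffOn ℂ _ E _ _ E _ 𝓘(ℂ, E) N D.topologicalSpace D.chartedSpace E _ _ E _ 𝓘(ℂ, E) M _ _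
      ω (D.part i) (D.part i).source := by
  let := D.topologicalSpace
  let := D.chartedSpace
  have := D.isManifold
  intro x hx
  set e := chartAt E (D.part i x)
  have hm : (D.homeo i).trans e ∈ IsManifold.maximalAtlas 𝓘(ℂ, E) ω N :=
    IsManifold.subset_maximalAtlas ⟨i, e, chart_mem_atlas E _, rfl⟩
  have hx' : x ∈ ((D.homeo i).trans e).source := by
    rw [OpenPartialHomeomorph.trans_source]
    exact ⟨hx, mem_chart_source E _⟩
  have h1 := contMDiffAt_of_mem_maximalAtlas hm hx'
  have h2 : ContMDiffAt 𝓘(ℂ, E) 𝓘(ℂ, E) ω e.symm (((D.homeo i).trans e) x) :=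
    (contMDiffOn_symm_of_mem_maximalAtlas
      (IsManifold.subset_maximalAtlas (chart_mem_atlas E _))).contMDiffAt
      (e.open_target.mem_nhds (e.map_source (mem_chart_source E _)))
  refine ((h2.comp x h1).congr_of_eventuallyEq ?_).contMDiffWithinAt
  filter_upwards [((D.homeo i).trans e).open_source.mem_nhds hx'] with y hy
  rw [OpenPartialHomeomorph.trans_source] at hy
  exact (e.left_inv hy.2).symm

theorem contMDiffOn_homeo_symm (i : ι) :
    @ContMDiffOn ℂ _ E _ _ E _ 𝓘(ℂ, E) M _ _ E _ _ E _ 𝓘(ℂ, E) N D.topologicalSpace D.chartedSpace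
      ω (D.part i).symm (D.part i).target := by
  let := D.topologicalSpace
  let := D.chartedSpace
  have := D.isManifold
  intro y hy
  set e := chartAt E y
  have hm : (D.homeo i).trans e ∈ IsManifold.maximalAtlas 𝓘(ℂ, E) ω N :=
    IsManifold.subset_maximalAtlas ⟨i, e, chart_mem_atlas E _, rfl⟩
  have h1 : ContMDiffAt 𝓘(ℂ, E) 𝓘(ℂ, E) ω e y := contMDiffAt_of_mem_maximalAtlas
    (IsManifold.subset_maximalAtlas (chart_mem_atlas E _)) (mem_chart_source E y)
  have hy' : e y ∈ ((D.homeo i).trans e).target := by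
    rw [OpenPartialHomeomorph.trans_target]
    refine ⟨e.map_source (mem_chart_source E _), ?_⟩
    change e.symm (e y) ∈ (D.part i).target
    rwa [e.left_inv (mem_chart_source E _)]
  have h2 := (contMDiffOn_symm_of_mem_maximalAtlas hm).contMDiffAt
    (((D.homeo i).trans e).open_target.mem_nhds hy')
  refine ((h2.comp y h1).congr_of_eventuallyEq ?_).contMDiffWithinAt
  filter_upwards [e.open_source.mem_nhds (mem_chart_source E y)] with z hz
  change _ = (D.part i).symm (e.symm (e z))
  rw [e.left_inv hz]

end ManifoldGluing

end GluingManifolds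

/-! ### The twistor group glued from a cocycle -/

namespace TwistorGroup

variable {G : TwistorGroup.{u}} (c : G.autSheaf.Cocycle)

/-- The total space of the group obtained by gluing: as a set it is the total space of `G`, the
fibre over `x` being identified with that of `G` through a chosen member of the covering. -/
def Glued (_c : G.autSheaf.Cocycle) : Type u := G.Total

namespace Glued

variable {c} {a b : Glued c} {i j : c.cover.ι}

def proj (a : Glued c) : CP1 := G.proj a

variable (c) in
/-- A member of the covering containing a given point. -/
noncomputable def idx (x : CP1) : c.cover.ι := (c.cover.covers x).choose

variable (c) in
theorem mem_idx (x : CP1) : x ∈ c.cover.U (idx c x) := (c.cover.covers x).choose_spec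

variable (c) in
/-- The identification of the part over `U i` with the part of `G` over `U i`. -/
noncomputable def part (i : c.cover.ι) : PartialEquiv (Glued c) G.Total where
  -- The point `a` stands for itself in the member of index `idx c (proj a)`, so its value in the
  -- member `i` is obtained by applying the transition from that index to `i`.
  toFun a := ev (c.φ i (idx c (proj a))) a
  invFun b := ev (c.φ (idx c (G.proj b)) i) b
  source := {a | proj a ∈ c.cover.U i}
  target := {b | G.proj b ∈ c.cover.U i}
  map_source' a ha := by
    have h := proj_ev (c.φ i (idx c (proj a))) (a := a) ⟨ha, mem_idx c _⟩
    change G.proj (ev _ a) ∈ c.cover.U i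
    rw [h]; exact ha
  map_target' b hb := by
    have h := proj_ev (c.φ (idx c (G.proj b)) i) ⟨mem_idx c _, hb⟩
    change G.proj (ev (c.φ (idx c (G.proj b)) i) b) ∈ c.cover.U i
    rw [h]; exact hb
  left_inv' a ha := by
    -- The cocycle preserves fibres, so the inverse map uses the same chosen index, and the two
    -- transitions cancel.
    have h := proj_ev (c.φ i (idx c (proj a))) (a := a) ⟨ha, mem_idx c _⟩
    rw [h]
    exact (ev_cocycle c (mem_idx c _) ha (mem_idx c _)).trans (ev_cocycle_self c (mem_idx c _))
  right_inv' b hb := by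
    have h := proj_ev (c.φ (idx c (G.proj b)) i) ⟨mem_idx c _, hb⟩
    change ev (c.φ i (idx c (G.proj (ev (c.φ (idx c (G.proj b)) i) b)))) _ = b
    rw [h, ev_cocycle c hb (mem_idx c _) hb, ev_cocycle_self c hb]

theorem proj_part (ha : proj a ∈ c.cover.U i) : G.proj (part c i a) = proj a :=
  proj_ev _ ⟨ha, mem_idx c _⟩

theorem proj_part_symm {b : G.Total} (hb : G.proj b ∈ c.cover.U i) :
    proj ((part c i).symm b) = G.proj b :=
  proj_ev (c.φ (idx c (G.proj b)) i) ⟨mem_idx c _, hb⟩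

theorem part_eq_ev (hi : proj a ∈ c.cover.U i) (hj : proj a ∈ c.cover.U j) :
    part c i a = ev (c.φ i j) (part c j a) :=
  (ev_cocycle c hi hj (mem_idx c _)).symm

theorem part_injective (ha : proj a ∈ c.cover.U i) (hb : proj b ∈ c.cover.U i)
    (hab : part c i a = part c i b) : a = b := (part c i).injOn ha hb hab

theorem transition_source : ((part c i).symm.trans (part c j)).source =
    G.restr (c.cover.U i ⊓ c.cover.U j) := by
  ext b
  refine and_congr_right fun hb => ?_
  change proj ((part c i).symm b) ∈ c.cover.U j ↔ _
  rw [proj_part_symm hb]; rfl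

variable (c) in
noncomputable def gluing : ManifoldGluing G.Model G.Total (Glued c) c.cover.ι where
  part := part c
  idx a := idx c (proj a)
  mem_source a := mem_idx c _
  isOpen_source i j := by rw [transition_source]; exact (G.restr _).isOpen
  contMDiffOn i j := by
    -- The chosen indices vary without any continuity, but they cancel in the transition from `i` to
    -- `j`, which is `φ j i`, a holomorphic map.
    rw [transition_source]
    refine ((localIso_ev (c.φ j i)).contMDiffOn.mono fun b hb => ⟨hb.2, hb.1⟩).congr
      fun b hb => ?_
    have h : proj ((part c i).symm b) = G.proj b := proj_part_symm hb.1
    change part c j ((part c i).symm b) = _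
    rw [part_eq_ev (i := j) (j := i) (by rw [h]; exact hb.2) (by rw [h]; exact hb.1),
      (part c i).right_inv hb.1]

noncomputable instance : TopologicalSpace (Glued c) := (gluing c).topologicalSpace

noncomputable instance : ChartedSpace G.Model (Glued c) := (gluing c).chartedSpace

instance : IsManifold 𝓘(ℂ, G.Model) ω (Glued c) := (gluing c).isManifold

variable (c) in
/-- The part over `U i`. -/
def restr (i : c.cover.ι) : Set (Glued c) := {a | proj a ∈ c.cover.U i}

theorem isOpen_restr : IsOpen (restr c i) := ((gluing c).homeo i).open_source

theorem contMDiffOn_part :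
    ContMDiffOn 𝓘(ℂ, G.Model) 𝓘(ℂ, G.Model) ω (part c i) (restr c i) :=
  (gluing c).contMDiffOn_homeo i

theorem contMDiffOn_part_symm :
    ContMDiffOn 𝓘(ℂ, G.Model) 𝓘(ℂ, G.Model) ω (part c i).symm (G.restr (c.cover.U i)) :=
  (gluing c).contMDiffOn_homeo_symm i

theorem contMDiffAt_part (ha : proj a ∈ c.cover.U i) :
    ContMDiffAt 𝓘(ℂ, G.Model) 𝓘(ℂ, G.Model) ω (part c i) a :=
  contMDiffOn_part.contMDiffAt (isOpen_restr.mem_nhds ha)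

theorem contMDiffAt_part_symm {b : G.Total} (hb : G.proj b ∈ c.cover.U i) :
    ContMDiffAt 𝓘(ℂ, G.Model) 𝓘(ℂ, G.Model) ω (part c i).symm b :=
  contMDiffOn_part_symm.contMDiffAt ((G.restr (c.cover.U i)).isOpen.mem_nhds hb)

theorem contMDiff_proj : ContMDiff 𝓘(ℂ, G.Model) 𝓘(ℂ) ω (proj : Glued c → CP1) := fun a => by
  refine ((G.contMDiff_proj _).comp a (contMDiffAt_part (mem_idx c (proj a)))
    ).congr_of_eventuallyEq ?_
  filter_upwards [isOpen_restr.mem_nhds (mem_idx c (proj a))] with b hb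
  exact (proj_part hb).symm

/-- Near `part c i a` the projection of `G` is `proj` composed with the inverse of the part. By the
chain rule its surjective derivative factors through that of `proj`. -/
theorem submersion (a : Glued c) :
    Function.Surjective (mfderiv 𝓘(ℂ, G.Model) 𝓘(ℂ) (proj : Glued c → CP1) a) := by
  set i := idx c (proj a)
  have ha : proj a ∈ c.cover.U i := mem_idx c _
  have hb : G.proj (part c i a) ∈ c.cover.U i := by rwa [proj_part ha]
  have h1 : (part c i).symm (part c i a) = a := (part c i).left_inv ha
  have h2 : G.proj =ᶠ[𝓝 (part c i a)] fun b => proj ((part c i).symm b) := by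
    filter_upwards [(G.restr (c.cover.U i)).isOpen.mem_nhds hb] with b hb
    exact (proj_part_symm hb).symm
  have h3 := G.submersion (part c i a)
  have h4 : MDifferentiableAt 𝓘(ℂ, G.Model) 𝓘(ℂ) (proj : Glued c → CP1)
      ((part c i).symm (part c i a)) := contMDiff_proj.mdifferentiable (by simp) _
  have h5 := h2.mfderiv_eq (I := 𝓘(ℂ, G.Model)) (I' := 𝓘(ℂ))
  have h6 := mfderiv_comp (part c i a) h4
    ((contMDiffAt_part_symm hb).mdifferentiableAt (by simp))
  rw [h5.trans h6] at h3
  rw [h1] at h3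
  exact fun v => (h3 v).imp' _ fun _ h => h

/-- Points in different fibres are separated through `CP1`. Points in the same fibre lie in one
common part, where they are separated in `G`. -/
instance : T2Space (Glued c) := ⟨fun a b hab => by
  by_cases h : proj a = proj b
  · set i := idx c (proj a)
    have ha : proj a ∈ c.cover.U i := mem_idx c _
    have hb : proj b ∈ c.cover.U i := h ▸ ha
    obtain ⟨u, v, hu, hv, hau, hbv, huv⟩ :=
      t2_separation (fun h' => hab (part_injective ha hb h') : part c i a ≠ part c i b)
    refine ⟨_, _, ((gluing c).homeo i).isOpen_inter_preimage hu,
      ((gluing c).homeo i).isOpen_inter_preimage hv, ⟨ha, hau⟩, ⟨hb, hbv⟩, ?_⟩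
    exact (huv.preimage _).mono inter_subset_right inter_subset_right
  · exact separated_by_continuous contMDiff_proj.continuous h⟩

/-! ### The group operations and the real structure -/

/-- Each fibre is read through a single index, so the operations of `G` can be kept unchanged and
the fibrewise group axioms hold verbatim. What has to be proved is holomorphy, by comparison with
`G` in the parts. -/
def mul (a b : Glued c) : Glued c := G.mul a b

variable (c) in
def one (x : CP1) : Glued c := G.one x

def inv (a : Glued c) : Glued c := G.inv a

/-- The real structure of `G` takes the representation in the index `idx x` to one in `bar (idx x)`.
The index chosen at the antipode may be a different one, hence the correction by `φ`. -/
noncomputable def τ (a : Glued c) : Glued c :=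
  ev (c.φ (idx c (antipode (proj a))) (c.cover.bar (idx c (proj a)))) (G.τ a)

theorem proj_mul (hab : proj a = proj b) : proj (mul a b) = proj a := G.proj_mul a b hab

theorem proj_τ : proj (τ a) = antipode (proj a) := by
  have h : G.proj (G.τ a) = antipode (proj a) := G.proj_τ a
  refine (proj_ev _ ?_).trans h
  rw [h]
  exact ⟨mem_idx c _, c.cover.antipode_mem (mem_idx c _)⟩

/-- On a single fibre the part is one fixed `φ i _`, which is multiplicative. -/
theorem part_mul (ha : proj a ∈ c.cover.U i) (hab : proj a = proj b) :
    part c i (mul a b) = G.mul (part c i a) (part c i b) := by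
  have h := proj_mul hab
  change ev (c.φ i (idx c (proj (mul a b)))) (G.mul a b) =
    G.mul (ev (c.φ i (idx c (proj a))) a) (ev (c.φ i (idx c (proj b))) b)
  rw [h, ← hab]
  exact (localIso_ev _).map_mul a b ⟨ha, mem_idx c _⟩ hab

theorem part_one {x : CP1} (hx : x ∈ c.cover.U i) : part c i (one c x) = G.one x := by
  have h : proj (one c x) = x := G.proj_one x
  change ev (c.φ i (idx c (proj (one c x)))) (G.one x) = _
  rw [h]
  exact (localIso_ev _).map_one ⟨hx, mem_idx c _⟩

theorem part_inv (ha : proj a ∈ c.cover.U i) : part c i (inv a) = G.inv (part c i a) := by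
  have h : proj (inv a) = proj a := G.proj_inv a
  change ev (c.φ i (idx c (proj (inv a)))) (G.inv a) = G.inv (ev (c.φ i (idx c (proj a))) a)
  rw [h]
  exact (localIso_ev _).map_inv (a := (a : G.Total)) ⟨ha, mem_idx c _⟩

/-- The cocycle relation merges the correction in `τ` with the transition to `bar i`, and reality of
the cocycle then moves `τ` outside. In the parts, `τ` is therefore the real structure of `G`. -/
theorem part_τ (ha : proj a ∈ c.cover.U i) :
    part c (c.cover.bar i) (τ a) = G.τ (part c i a) := by
  have h : G.proj (G.τ a) = antipode (proj a) := G.proj_τ a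
  change ev (c.φ (c.cover.bar i) (idx c (proj (τ a)))) (ev _ (G.τ a)) = _
  rw [proj_τ, ev_cocycle, ev_real]
  · exact congrArg (fun b => G.τ (ev (c.φ i (idx c (proj a))) b)) (G.τ_τ a)
  all_goals rw [h]
  any_goals exact mem_idx c _
  all_goals first | exact c.cover.antipode_mem ha | exact c.cover.antipode_mem (mem_idx c _)

theorem mem_bar (ha : proj a ∈ c.cover.U i) : proj (τ a) ∈ c.cover.U (c.cover.bar i) := by
  rw [proj_τ]; exact c.cover.antipode_mem ha

/-- Two points of one fibre lie in a common part, and on the fibre product over that part the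
multiplication is that of `G` conjugated by `part c i`. -/
theorem contMDiffOn_mul : ContMDiffOn (𝓘(ℂ, G.Model).prod 𝓘(ℂ, G.Model)) 𝓘(ℂ, G.Model) ω
    (fun p : Glued c × Glued c => mul p.1 p.2) {p | proj p.1 = proj p.2} := by
  refine contMDiffOn_of_locally_contMDiffOn fun p hp => ?_
  set i := idx c (proj p.1)
  refine ⟨Prod.fst ⁻¹' restr c i, isOpen_restr.preimage continuous_fst, mem_idx c _, ?_⟩
  have h1 : ContMDiffOn (𝓘(ℂ, G.Model).prod 𝓘(ℂ, G.Model))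
      (𝓘(ℂ, G.Model).prod 𝓘(ℂ, G.Model)) ω
      (fun p : Glued c × Glued c => (part c i p.1, part c i p.2))
      ({p | proj p.1 = proj p.2} ∩ Prod.fst ⁻¹' restr c i) :=
    (contMDiffOn_part.comp contMDiffOn_fst fun p hp => hp.2).prodMk
      (contMDiffOn_part.comp contMDiffOn_snd fun p hp => by
        change proj p.2 ∈ c.cover.U i
        rw [← show proj p.1 = proj p.2 from hp.1]; exact hp.2)
  have h2 : ∀ p ∈ ({p | proj p.1 = proj p.2} ∩ Prod.fst ⁻¹' restr c i : Set (Glued c × Glued c)),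
      G.proj (part c i p.1) = proj p.1 ∧ G.proj (part c i p.2) = proj p.1 := fun p hp => by
    have e : proj p.1 = proj p.2 := hp.1
    refine ⟨proj_part hp.2, ?_⟩
    rw [proj_part, e]
    rw [← e]; exact hp.2
  have h3 := contMDiffOn_part_symm.comp (G.contMDiffOn_mul.comp h1 fun p hp => by
      obtain ⟨e1, e2⟩ := h2 p hp
      exact e1.trans e2.symm) fun p hp => by
    obtain ⟨e1, e2⟩ := h2 p hp
    change G.proj _ ∈ c.cover.U i
    simp only [Function.comp]
    rw [G.proj_mul _ _ (e1.trans e2.symm), e1]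
    exact hp.2
  refine h3.congr fun p hp => ?_
  have hm : proj (mul p.1 p.2) ∈ c.cover.U i := by rw [proj_mul hp.1]; exact hp.2
  exact ((congrArg _ (part_mul hp.2 hp.1)).symm.trans ((part c i).left_inv hm)).symm

theorem contMDiff_one : ContMDiff 𝓘(ℂ) 𝓘(ℂ, G.Model) ω (one c) := fun x => by
  have hx := mem_idx c x
  refine (ContMDiffAt.comp x (contMDiffAt_part_symm (by rwa [G.proj_one]))
    (G.contMDiff_one x)).congr_of_eventuallyEq ?_
  filter_upwards [(c.cover.U (idx c x)).isOpen.mem_nhds hx] with y hy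
  have h : proj (one c y) ∈ c.cover.U (idx c x) := by
    rw [show proj (one c y) = y from G.proj_one y]; exact hy
  exact ((congrArg _ (part_one hy)).symm.trans ((part c _).left_inv h)).symm

theorem contMDiff_inv : ContMDiff 𝓘(ℂ, G.Model) 𝓘(ℂ, G.Model) ω (inv : Glued c → Glued c) :=
    fun a => by
  have ha := mem_idx c (proj a)
  refine (ContMDiffAt.comp a (contMDiffAt_part_symm (i := idx c (proj a))
    (by rw [Function.comp, G.proj_inv, proj_part ha]; exact ha))
    ((G.contMDiff_inv _).comp a (contMDiffAt_part ha))).congr_of_eventuallyEq ?_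
  filter_upwards [isOpen_restr.mem_nhds ha] with b hb
  have h : proj (inv b) ∈ c.cover.U (idx c (proj a)) := by
    rw [show proj (inv b) = proj b from G.proj_inv b]; exact hb
  exact ((congrArg _ (part_inv hb)).symm.trans ((part c _).left_inv h)).symm

/-- The definition of `τ` involves choices that vary with the point. Near a given point it agrees
with an expression in fixed indices, from which antiholomorphy can be read off. -/
theorem τ_eventuallyEq (ha : proj a ∈ c.cover.U i) :
    τ =ᶠ[𝓝 a] fun b => (part c (c.cover.bar i)).symm (G.τ (part c i b)) := by
  filter_upwards [isOpen_restr.mem_nhds ha] with b hb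
  rw [← part_τ hb]
  exact ((part c _).left_inv (mem_bar hb)).symm

theorem antiHolomorphic_τ : AntiHolomorphic G.Model G.Model (τ : Glued c → Glued c) := by
  have hτ {a : Glued c} {i} (ha : proj a ∈ c.cover.U i) :
      G.proj (G.τ (part c i a)) ∈ c.cover.U (c.cover.bar i) := by
    rw [G.proj_τ, proj_part ha]; exact c.cover.antipode_mem ha
  refine ⟨continuous_iff_continuousAt.2 fun a => ?_, fun a h hh => ?_⟩
  · have ha := mem_idx c (proj a)
    refine ContinuousAt.congr ?_ (τ_eventuallyEq ha).symm
    exact ContinuousAt.comp (contMDiffAt_part_symm (hτ ha)).continuousAt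
      (G.antiHolomorphic_τ.continuous.continuousAt.comp (contMDiffAt_part ha).continuousAt)
  · have ha := mem_idx c (proj a)
    set i := idx c (proj a)
    rw [(τ_eventuallyEq ha).self_of_nhds] at hh
    have h1 := G.antiHolomorphic_τ.pullback (part c i a) _
      (hh.comp _ (contMDiffAt_part_symm (hτ ha)))
    refine (h1.comp a (contMDiffAt_part ha)).congr_of_eventuallyEq ?_
    filter_upwards [τ_eventuallyEq ha] with b hb
    rw [hb]; rfl

/-- As for the following identities, both sides are compared inside one part, where `part_τ` turns
the claim into the corresponding axiom of `G`. -/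
theorem τ_τ (a : Glued c) : τ (τ a) = a := by
  have ha := mem_idx c (proj a)
  have h1 := mem_bar (mem_bar ha)
  have h2 := part_τ (mem_bar ha)
  rw [part_τ ha, G.τ_τ, c.cover.bar_bar] at h2
  rw [c.cover.bar_bar] at h1
  exact part_injective h1 ha h2

theorem τ_mul (hab : proj a = proj b) : τ (mul a b) = mul (τ a) (τ b) := by
  have ha := mem_idx c (proj a)
  have hm : proj (mul a b) ∈ c.cover.U (idx c (proj a)) := by rwa [proj_mul hab]
  have hp : proj (τ a) = proj (τ b) := by rw [proj_τ, proj_τ, hab]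
  refine part_injective (mem_bar hm) (by rw [proj_mul hp]; exact mem_bar ha) ?_
  rw [part_τ hm, part_mul ha hab, part_mul (mem_bar ha) hp, part_τ ha, part_τ (hab ▸ ha),
    G.τ_mul]
  rw [proj_part ha, proj_part (hab ▸ ha), hab]

theorem τ_one (x : CP1) : τ (one c x) = one c (antipode x) := by
  have hx := mem_idx c x
  have hp (y : CP1) : proj (one c y) = y := G.proj_one y
  have h1 : proj (one c x) ∈ c.cover.U (idx c x) := by rwa [hp]
  refine part_injective (mem_bar h1) (by rw [hp]; exact c.cover.antipode_mem hx) ?_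
  rw [part_τ h1, part_one hx, part_one (c.cover.antipode_mem hx), G.τ_one]

theorem τ_inv (a : Glued c) : τ (inv a) = inv (τ a) := by
  have ha := mem_idx c (proj a)
  have hp (b : Glued c) : proj (inv b) = proj b := G.proj_inv b
  have h1 : proj (inv a) ∈ c.cover.U (idx c (proj a)) := by rwa [hp]
  refine part_injective (mem_bar h1) (by rw [hp]; exact mem_bar ha) ?_
  rw [part_τ h1, part_inv ha, part_inv (mem_bar ha), part_τ ha, G.τ_inv]

end Glued

/-- The twistor group obtained from a cocycle by gluing. -/
noncomputable def glued : TwistorGroup.{u} where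
  Model := G.Model
  Total := Glued c
  proj := Glued.proj
  contMDiff_proj := Glued.contMDiff_proj
  submersion := Glued.submersion
  mul := Glued.mul
  one := Glued.one c
  inv := Glued.inv
  proj_mul := G.proj_mul
  proj_one := G.proj_one
  proj_inv := G.proj_inv
  mul_assoc := G.mul_assoc
  one_mul := G.one_mul
  mul_one := G.mul_one
  inv_mul := G.inv_mul
  contMDiffOn_mul := Glued.contMDiffOn_mul
  contMDiff_one := Glued.contMDiff_one
  contMDiff_inv := Glued.contMDiff_inv
  τ := Glued.τ
  antiHolomorphic_τ := Glued.antiHolomorphic_τ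
  τ_τ := Glued.τ_τ
  proj_τ _ := Glued.proj_τ
  τ_mul _ _ := Glued.τ_mul
  τ_one := Glued.τ_one
  τ_inv := Glued.τ_inv

theorem localIso_part (i : c.cover.ι) : LocalIso (glued c) G (c.cover.U i)
    (Glued.part c i) (Glued.part c i).symm := by
  refine ⟨?_, ?_, ?_, ?_, ?_, ?_, ?_⟩
  · exact fun _ ha => Glued.proj_part ha
  · exact fun _ hb => Glued.proj_part_symm hb
  · exact fun _ ha => (Glued.part c i).left_inv ha
  · exact fun _ hb => (Glued.part c i).right_inv hb
  · exact Glued.contMDiffOn_part (c := c) (i := i)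
  · exact Glued.contMDiffOn_part_symm (c := c) (i := i)
  · exact fun _ _ => Glued.part_mul

theorem isGluedBy_glued : G.IsGluedBy (glued c) c :=
  (isGluedBy_iff (H := glued c) c).2 ⟨fun i => Glued.part c i, fun i => (Glued.part c i).symm,
    localIso_part c, fun _ _ => Glued.part_τ, fun _ _ _ => Glued.part_eq_ev⟩

theorem exists_bijective_localForms (G : TwistorGroup.{u}) :
    ∃ F : G.LocalForms → G.autSheaf.H1R, Function.Bijective F ∧
      ∀ (H : {H : TwistorGroup.{u} // G.LocallyIso H}) (c : G.autSheaf.Cocycle),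
        F (Quot.mk _ H) = Quot.mk _ c ↔ G.IsGluedBy H.1 c :=
  exists_bijective_of_gluing (fun H c => G.IsGluedBy H c) (fun _ => exists_isGluedBy)
    (fun c => ⟨glued c, locallyIso_of_isGluedBy (isGluedBy_glued c), isGluedBy_glued c⟩)
    cohomologous_of_isGluedBy isGluedBy_of_cohomologous exists_isIso_of_isGluedBy
    fun he hH => hH.of_isIso he

end TwistorGroup

end Twistor

/-! ### Transport of cocycles along isomorphisms of presheaves -/

namespace Twistor

open RealGroupPresheaf

namespace RealGroupPresheaf

/-- An isomorphism of presheaves of groups with real structure. -/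
structure Iso (A B : RealGroupPresheaf.{u}) where
  equiv : ∀ U, A.sec U ≃* B.sec U
  map_res : ∀ {V U : Opens CP1} (h : V ≤ U) (a : A.sec U),
    equiv V (A.res h a) = B.res h (equiv U a)
  map_conjSec : ∀ {U : Opens CP1} (a : A.sec U),
    equiv _ (A.conjSec a) = B.conjSec (equiv U a)

namespace Iso

variable {A B : RealGroupPresheaf.{u}} (α : Iso A B)

noncomputable def symm : Iso B A where
  equiv U := (α.equiv U).symm
  map_res h a := by rw [MulEquiv.symm_apply_eq, α.map_res, MulEquiv.apply_symm_apply]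
  map_conjSec a := by rw [MulEquiv.symm_apply_eq, α.map_conjSec, MulEquiv.apply_symm_apply]

noncomputable def mapCocycle (c : A.Cocycle) : B.Cocycle where
  cover := c.cover
  φ i j := α.equiv _ (c.φ i j)
  cocycle i j k := by
    rw [← α.map_res, ← α.map_res, ← α.map_res, ← map_mul, c.cocycle]
  real i j := by
    rw [c.real, ← α.map_conjSec]
    exact α.map_res _ (A.conjSec (c.φ i j))

theorem mapCocycle_symm (c : B.Cocycle) : α.mapCocycle (α.symm.mapCocycle c) = c := by
  rcases c with ⟨W, φ, h1, h2⟩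
  have h (i j) : α.equiv (W.U i ⊓ W.U j) (α.symm.equiv _ (φ i j)) = φ i j :=
    (α.equiv _).apply_symm_apply _
  have h' : (fun i j => α.equiv (W.U i ⊓ W.U j) (α.symm.equiv _ (φ i j))) = φ :=
    funext fun i => funext fun j => h i j
  -- The other fields are the covering, which is unchanged, and proofs; only the transition sections
  -- have to be compared, by `h'`.
  simp only [mapCocycle]
  congr 1

theorem cohomologous {c d : A.Cocycle} (h : Cohomologous c d) :
    Cohomologous (α.mapCocycle c) (α.mapCocycle d) := by
  obtain ⟨W, r, s, hr, hs, a, h1, h2, h3, h4⟩ := h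
  refine ⟨W, r, s, hr, hs, fun k => α.equiv _ (a k), h1, h2, fun k => ?_, fun k l => ?_⟩
  · beta_reduce
    rw [h3, α.map_res, α.map_conjSec]
  · have h := congrArg (α.equiv _) (h4 k l)
    rw [map_mul, map_mul, map_inv] at h
    simp only [α.map_res] at h
    exact h

theorem cohomologous_iff {c d : A.Cocycle} :
    Cohomologous (α.mapCocycle c) (α.mapCocycle d) ↔ Cohomologous c d := by
  refine ⟨fun h => ?_, α.cohomologous⟩
  have h' := α.symm.cohomologous h
  have e (c : A.Cocycle) : α.symm.mapCocycle (α.mapCocycle c) = c := α.symm.mapCocycle_symm c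
  rwa [e, e] at h'

end Iso

end RealGroupPresheaf

/-- Unlike in `contMDiff_codRestrict`, the source has an arbitrary model with corners, as needed for
`U × G` with its product model. -/
theorem contMDiff_codRestrict_opens {E' H' M' F N : Type*} [NormedAddCommGroup E']
    [NormedSpace ℂ E'] [TopologicalSpace H'] [TopologicalSpace M'] [ChartedSpace H' M']
    {I : ModelWithCorners ℂ E' H'} [NormedAddCommGroup F] [NormedSpace ℂ F] [TopologicalSpace N]
    [ChartedSpace F N] {V : Opens N} {f : M' → V}
    (hf : ContMDiff I 𝓘(ℂ, F) ω (fun x => (f x : N))) : ContMDiff I 𝓘(ℂ, F) ω f := fun x =>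
  (ChartedSpace.liftPropWithinAt_subtypeVal_comp_iff f univ x).1 (hf x)

/-! ### Automorphisms of the trivial twistor group as families of automorphisms of `G` -/

section LieGroup

variable {E G : Type u} [NormedAddCommGroup E] [NormedSpace ℂ E] [FiniteDimensional ℂ E]
  [TopologicalSpace G] [T2Space G] [ChartedSpace E G] [Group G] [LieGroup 𝓘(ℂ, E) ω G]

variable {s : G ≃* G} {hs : AntiHolomorphic E E s} {hss : ∀ g, s (s g) = g} {U : Opens CP1}

/-- The automorphism over `U` of the trivial group given by a family of automorphisms of `G`. -/
noncomputable def familyPerm (f : U → MulAut G) :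
    Equiv.Perm ((trivialTwistorGroup s hs hss).restr U) where
  toFun a := ⟨(f ⟨a.1.2, a.2⟩ a.1.1, a.1.2), a.2⟩
  invFun a := ⟨((f ⟨a.1.2, a.2⟩).symm a.1.1, a.1.2), a.2⟩
  left_inv a := Subtype.ext (Prod.ext ((f ⟨a.1.2, a.2⟩).symm_apply_apply a.1.1) rfl)
  right_inv a := Subtype.ext (Prod.ext ((f ⟨a.1.2, a.2⟩).apply_symm_apply a.1.1) rfl)

theorem contMDiff_trivial_fst : ContMDiff 𝓘(ℂ, (trivialTwistorGroup s hs hss).Model) 𝓘(ℂ, E) ω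
    (fun a : (trivialTwistorGroup s hs hss).restr U => (a.1.1 : G)) :=
  ContMDiff.comp (I' := 𝓘(ℂ, (trivialTwistorGroup s hs hss).Model))
    (g := fun a : (trivialTwistorGroup s hs hss).Total => (a.1 : G))
    (contMDiff_lie_fst (E := E) (G := G)) contMDiff_subtype_val

theorem contMDiff_trivial_snd : ContMDiff 𝓘(ℂ, (trivialTwistorGroup s hs hss).Model) 𝓘(ℂ) ω
    (fun a : (trivialTwistorGroup s hs hss).restr U => (⟨a.1.2, a.2⟩ : U)) :=
  contMDiff_codRestrict_opens ((trivialTwistorGroup s hs hss).contMDiff_proj.comp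
    contMDiff_subtype_val)

theorem contMDiff_trivial_mk {E' H' M' : Type*} [NormedAddCommGroup E'] [NormedSpace ℂ E']
    [TopologicalSpace H'] [TopologicalSpace M'] [ChartedSpace H' M']
    {I : ModelWithCorners ℂ E' H'} {f : M' → G} {f' : M' → U}
    (hf : ContMDiff I 𝓘(ℂ, E) ω f) (hf' : ContMDiff I 𝓘(ℂ) ω f') :
    ContMDiff I 𝓘(ℂ, (trivialTwistorGroup s hs hss).Model) ω
      (fun x => (⟨(f x, f' x), (f' x).2⟩ : (trivialTwistorGroup s hs hss).restr U)) :=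
  contMDiff_codRestrict_opens (V := (trivialTwistorGroup s hs hss).restr U)
    (contMDiff_lie_mk hf (contMDiff_subtype_val.comp hf'))

theorem contMDiff_family {f : U → G → G}
    (hf : ContMDiff (𝓘(ℂ).prod 𝓘(ℂ, E)) 𝓘(ℂ, E) ω (fun p : U × G => f p.1 p.2)) :
    ContMDiff 𝓘(ℂ, (trivialTwistorGroup s hs hss).Model)
      𝓘(ℂ, (trivialTwistorGroup s hs hss).Model) ω
      (fun a : (trivialTwistorGroup s hs hss).restr U =>
        (⟨(f ⟨a.1.2, a.2⟩ a.1.1, a.1.2), a.2⟩ : (trivialTwistorGroup s hs hss).restr U)) :=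
  contMDiff_trivial_mk (hf.comp (contMDiff_trivial_snd.prodMk contMDiff_trivial_fst))
    contMDiff_trivial_snd

theorem isOverIso_familyPerm {f : U → MulAut G} (hf : f ∈ autSections E G U) :
    TwistorGroup.IsOverIso (familyPerm (s := s) (hs := hs) (hss := hss) f) where
  contMDiff := contMDiff_family (f := fun x g => f x g) hf.1
  contMDiff_symm := contMDiff_family (f := fun x g => (f x).symm g) hf.2
  proj _ := rfl
  map_mul := by
    rintro ⟨⟨g, x⟩, hx⟩ ⟨⟨h, y⟩, hy⟩ hxy
    -- Points of one fibre share their base coordinate, so one and the same automorphism of `G` acts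
    -- on both.
    obtain rfl : x = y := hxy
    exact Prod.ext (map_mul (f ⟨x, hx⟩) g h) rfl

/-- The family of automorphisms of `G` given by an automorphism of the trivial group. -/
noncomputable def permFamily {e : Equiv.Perm ((trivialTwistorGroup s hs hss).restr U)}
    (he : TwistorGroup.IsOverIso e) (x : U) : MulAut G where
  toFun g := (e ⟨(g, x), x.2⟩).1.1
  invFun g := (e.symm ⟨(g, x), x.2⟩).1.1
  left_inv g := by
    have h : (e ⟨(g, x), x.2⟩).1.2 = x := he.proj ⟨(g, x), x.2⟩
    -- Since `e` covers the identity, its value is recovered from its first coordinate and `x`.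
    have h1 : (⟨((e ⟨(g, x), x.2⟩).1.1, x), x.2⟩ : (trivialTwistorGroup s hs hss).restr U) =
      e ⟨(g, x), x.2⟩ := Subtype.ext (Prod.ext rfl h.symm)
    change (e.symm ⟨((e ⟨(g, x), x.2⟩).1.1, x), x.2⟩).1.1 = g
    rw [h1, e.symm_apply_apply]
  right_inv g := by
    have h : (e.symm ⟨(g, x), x.2⟩).1.2 = x := he.proj_symm ⟨(g, x), x.2⟩
    have h1 : (⟨((e.symm ⟨(g, x), x.2⟩).1.1, x), x.2⟩ : (trivialTwistorGroup s hs hss).restr U) =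
      e.symm ⟨(g, x), x.2⟩ := Subtype.ext (Prod.ext rfl h.symm)
    change (e ⟨((e.symm ⟨(g, x), x.2⟩).1.1, x), x.2⟩).1.1 = g
    rw [h1, e.apply_symm_apply]
  map_mul' g h := congrArg Prod.fst (he.map_mul ⟨(g, x), x.2⟩ ⟨(h, x), x.2⟩ rfl)

theorem contMDiff_permFamily
    {e : (trivialTwistorGroup s hs hss).restr U → (trivialTwistorGroup s hs hss).restr U}
    (he : ContMDiff 𝓘(ℂ, (trivialTwistorGroup s hs hss).Model)
      𝓘(ℂ, (trivialTwistorGroup s hs hss).Model) ω e) :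
    ContMDiff (𝓘(ℂ).prod 𝓘(ℂ, E)) 𝓘(ℂ, E) ω
      (fun p : U × G => (e ⟨(p.2, p.1), p.1.2⟩).1.1) := by
  exact contMDiff_trivial_fst.comp (he.comp (contMDiff_trivial_mk contMDiff_snd contMDiff_fst))

theorem permFamily_mem {e : Equiv.Perm ((trivialTwistorGroup s hs hss).restr U)}
    (he : TwistorGroup.IsOverIso e) : permFamily he ∈ autSections E G U :=
  ⟨contMDiff_permFamily he.contMDiff, contMDiff_permFamily he.contMDiff_symm⟩

variable (s hs hss) in
/-- The sheaf of holomorphic maps to `Aut G` is the sheaf of automorphisms of the trivial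
twistor group. -/
noncomputable def autIso : Iso (autValuedSheaf s hs hss) (trivialTwistorGroup s hs hss).autSheaf where
  equiv U :=
    { toFun := fun f => ⟨familyPerm (Subtype.val (p := (· ∈ autSections E G U)) f),
        isOverIso_familyPerm f.2⟩
      invFun := fun e => ⟨permFamily (TwistorGroup.isOverIso_secPerm e), permFamily_mem _⟩
      left_inv := fun f => rfl
      right_inv := fun e => Subtype.ext <| Equiv.ext fun a => Subtype.ext <|
        Prod.ext rfl ((TwistorGroup.isOverIso_secPerm e).proj a).symm
      map_mul' := fun _ _ => rfl }
  map_res _ _ := rfl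
  map_conjSec f := by
    -- In the group coordinate both sides are `s ∘ f (antipode x) ∘ s`. In the base coordinate the
    -- conjugate applies the antipodal map twice.
    refine Subtype.ext <| Equiv.ext fun a => Subtype.ext <| Prod.ext rfl ?_
    exact (antipode_antipode a.1.2).symm

/-- Both notions use the same trivializations. The gluing relation is only an equation of first
coordinates, since the second coordinates are forced by compatibility with the projections. -/
theorem isGluedByTransition_iff {H : TwistorGroup.{u}} (c : (autValuedSheaf s hs hss).Cocycle) :
    IsGluedByTransition H c ↔
      (trivialTwistorGroup s hs hss).IsGluedBy H ((autIso s hs hss).mapCocycle c) := by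
  refine exists_congr fun t => ⟨fun h i j a hi hj b hb => ?_, fun h i j a hi hj => ?_⟩
  · obtain ⟨⟨g, x⟩, hx⟩ := b
    have hp : (t.map j ⟨a, hj⟩).1.2 = H.proj a := (t.isOverIso j).proj ⟨a, hj⟩
    have hpi : (t.map i ⟨a, hi⟩).1.2 = H.proj a := (t.isOverIso i).proj ⟨a, hi⟩
    obtain rfl : g = (t.map j ⟨a, hj⟩).1.1 := congrArg Prod.fst hb
    obtain rfl : x = H.proj a := (congrArg Prod.snd hb).trans hp
    exact Prod.ext (h i j a hi hj) hpi
  · have hp : (t.map j ⟨a, hj⟩).1.2 = H.proj a := (t.isOverIso j).proj ⟨a, hj⟩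
    exact congrArg Prod.fst (h i j a hi hj ⟨((t.map j ⟨a, hj⟩).1.1, H.proj a), hi, hj⟩
      (Prod.ext rfl hp.symm))

/-- Cocycles are relabelled by `autIso`, which preserves and reflects being cohomologous and is
surjective on cocycles, so the six properties of gluing are inherited from the automorphism sheaf.
-/
theorem exists_bijective_localForms_trivial (s : G ≃* G) (hs : AntiHolomorphic E E s)
    (hss : ∀ g, s (s g) = g) :
    ∃ F : (trivialTwistorGroup s hs hss).LocalForms → (autValuedSheaf s hs hss).H1R,
      Function.Bijective F ∧
      ∀ (H : {H : TwistorGroup.{u} // (trivialTwistorGroup s hs hss).LocallyIso H})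
        (c : (autValuedSheaf s hs hss).Cocycle),
        F (Quot.mk _ H) = Quot.mk _ c ↔ IsGluedByTransition H.1 c := by
  refine TwistorGroup.exists_bijective_of_gluing (fun H c => IsGluedByTransition H c) ?_ ?_ ?_ ?_
    ?_ ?_
  all_goals simp only [isGluedByTransition_iff]
  · intro H hH
    obtain ⟨c, hc⟩ := TwistorGroup.exists_isGluedBy hH
    exact ⟨(autIso s hs hss).symm.mapCocycle c, by rwa [Iso.mapCocycle_symm]⟩
  · intro c
    have h := TwistorGroup.isGluedBy_glued ((autIso s hs hss).mapCocycle c)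
    exact ⟨_, TwistorGroup.locallyIso_of_isGluedBy h, h⟩
  · exact fun h h' => (autIso s hs hss).cohomologous_iff.1
      (TwistorGroup.cohomologous_of_isGluedBy h h')
  · exact fun h h' => TwistorGroup.isGluedBy_of_cohomologous ((autIso s hs hss).cohomologous h) h'
  · exact TwistorGroup.exists_isIso_of_isGluedBy
  · exact fun he h => h.of_isIso he

end LieGroup

end Twistor

theorem mainTheorem6 :
    (∀ G : Twistor.TwistorGroup.{u},
      ∃ F : G.LocalForms → G.autSheaf.H1R, Function.Bijective F ∧
        ∀ (H : {H : Twistor.TwistorGroup.{u} // G.LocallyIso H}) (c : G.autSheaf.Cocycle),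
          F (Quot.mk _ H) = Quot.mk _ c ↔ G.IsGluedBy H.1 c) ∧
    (∀ (E G : Type u) [NormedAddCommGroup E] [NormedSpace ℂ E] [FiniteDimensional ℂ E]
      [TopologicalSpace G] [T2Space G] [ChartedSpace E G] [Group G] [LieGroup 𝓘(ℂ, E) ω G]
      (s : G ≃* G) (hs : Twistor.AntiHolomorphic E E s) (hss : ∀ g, s (s g) = g),
      ∃ F : (Twistor.trivialTwistorGroup s hs hss).LocalForms →
          (Twistor.autValuedSheaf s hs hss).H1R,
        Function.Bijective F ∧
        ∀ (H : {H : Twistor.TwistorGroup.{u} //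
            (Twistor.trivialTwistorGroup s hs hss).LocallyIso H})
          (c : (Twistor.autValuedSheaf s hs hss).Cocycle),
          F (Quot.mk _ H) = Quot.mk _ c ↔ Twistor.IsGluedByTransition H.1 c) :=
  ⟨Twistor.TwistorGroup.exists_bijective_localForms,
    fun _ _ _ _ _ _ _ _ _ _ s hs hss =>
      Twistor.exists_bijective_localForms_trivial s hs hss⟩
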